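/- Let $(\xi_k)_{k\ge 0}$ be independent copies of a complex-valued random variable $\xi$ with $$\mathbb E[\xi]=0,\qquad \sigma_1^2:=\mathbb E[(\Re\xi)^2]<\infty,\qquad \sigma_2^2:=\mathbb E[(\Im\xi)^2]<\infty,\qquad \sigma^2:=\sigma_1^2+\sigma_2^2>0,\qquad \mathrm{Cov}[\Re\xi,\Im\xi]=0.$$ Let $\alpha>-\tfrac12$ and let $b:[0,\infty)\to\mathbb R$ be an eventually positive measurable function that varies regularly at $+\infty$ with index $\alpha$, that is, $b(x)=x^{\alpha}\ell(x)$ for $x>0$, where $\ell$ is measurable, eventually positive and $\ell(\lambda x)/\ell(x)\to1$ as $x\to+\infty$ for every $\lambda>0$. Put $P_n(z):=\sum_{k=0}^n b(k)\xi_k z^k$. Let $\mathcal A(\mathbb C)$ be the space of entire functions with the topology of locally uniform convergence, and $\mathcal A(\mathbb C)^m$ its $m$-fold product with the product topology. Then, for every $m\in\mathbb N$ and all distinct $\psi_1,\dots,\psi_m\in[0,2\pi)$, as $n\to\infty$, $$\left(\frac{P_n(e^{i\psi_1+u/n})}{b(n)\sqrt n},\dots,\frac{P_n(e^{i\psi_m+u/n})}{b(n)\sqrt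 n}\right)_{u\in\mathbb C}\Longrightarrow \big(G_{\psi_1}(u),\dots,G_{\psi_m}(u)\big)_{u\in\mathbb C}$$ in distribution on $\mathcal A(\mathbb C)^m$. Here $(G_{\psi_1},\dots,G_{\psi_m})$ is a random element of $\mathcal A(\mathbb C)^m$ (such an element exists) which is centred and jointly Gaussian, in the sense that all its finite-dimensional distributions are (not necessarily circular) complex Gaussian, with the following covariance structure for all $u_1,u_2\in\mathbb C$. For each $j$, $$\mathbb E[G_{\psi_j}(u_1)\overline{G_{\psi_j}(u_2)}]=\sigma^2\int_0^1x^{2\alpha}e^{x(u_1+\overline{u_2})}\,dx,$$ $$\mathbb E[G_{\psi_j}(u_1)G_{\psi_j}(u_2)]=\begin{cases}(\sigma_1^2-\sigma_2^2)\int_0^1x^{2\alpha}e^{x(u_1+u_2)}\,dx,&\psi_j\in\{0,\pi\},\\0,&\psi_j\in(0,\pi)\cup(\pi,2\pi),\end{cases}$$ and, for $i\neq j$, $$\mathbb E[G_{\psi_i}(u_1)\overline{G_{\psi_j}(u_2)}]=0,$$ $$\mathbb E[G_{\psi_i}(u_1)G_{\psi_j}(u_2)]=\begin{cases}(\sigma_1^2-\sigma_2^2)\int_0^1x^{2\alpha}e^{x(u_1+u_2)}\,dx,&\psi_i+\psi_j=2\pi,\\0,&\psi_i+\psi_j\neq2\pi.\end{cases}$$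 -/

import Mathlib

open MeasureTheory ProbabilityTheory Filter Topology

noncomputable section

namespace LiquidPhase

/-- A slowly varying function at `+∞`: it is measurable on `(0, ∞)`, eventually positive, and
`ℓ (c x) / ℓ x → 1` as `x → +∞` for every `c > 0`.  Only the values on `(0, ∞)` matter. -/
structure IsSlowlyVarying (ℓ : ℝ → ℝ) : Prop where
  measurable : Measurable fun x : Set.Ioi (0 : ℝ) => ℓ x
  eventually_pos : ∀ᶠ x in atTop, 0 < ℓ x
  tendsto_ratio : ∀ c : ℝ, 0 < c → Tendsto (fun x => ℓ (c * x) / ℓ x) atTop (𝓝 1)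

/-- `b : [0, ∞) → ℝ` varies regularly at `+∞` with index `α`: `b x = x ^ α * ℓ x` for `x > 0`, with
`ℓ` slowly varying.  The values of `b` on the negative half-line are irrelevant, and `b 0` is
arbitrary. -/
def IsRegularlyVarying (b : ℝ → ℝ) (α : ℝ) : Prop :=
  ∃ ℓ : ℝ → ℝ, IsSlowlyVarying ℓ ∧ ∀ x : ℝ, 0 < x → b x = x ^ α * ℓ x

/-- The space `𝒜(ℂ)` of entire functions. -/
def Entire : Type := {f : C(ℂ, ℂ) // Differentiable ℂ f}

namespace Entire

instance : CoeFun Entire (fun _ => ℂ → ℂ) := ⟨fun f => f.1⟩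

/-- The topology of locally uniform convergence (the compact-open topology). -/
instance : TopologicalSpace Entire :=
  inferInstanceAs (TopologicalSpace {f : C(ℂ, ℂ) // Differentiable ℂ f})

/-- A sequence (or net) converges in `𝒜(ℂ)` exactly when it converges locally uniformly. -/
theorem tendsto_iff {ι : Type*} {p : Filter ι} {F : ι → Entire} {f : Entire} :
    Tendsto F p (𝓝 f) ↔ TendstoLocallyUniformly (fun i z => F i z) f p := by
  rw [← ContinuousMap.tendsto_iff_tendstoLocallyUniformly (F := fun i => (F i).1) (f := f.1)]
  exact tendsto_subtype_rng

instance : SecondCountableTopology Entire :=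
  TopologicalSpace.Subtype.secondCountableTopology {f : C(ℂ, ℂ) | Differentiable ℂ f}

/-- The Borel `σ`-algebra. -/
instance : MeasurableSpace Entire := borel Entire

instance : BorelSpace Entire := ⟨rfl⟩

end Entire

/-- The random polynomial `P_n(z) = ∑_{k=0}^n b(k) ξ_k z^k`. -/
def randPoly {Ω : Type*} (b : ℝ → ℝ) (ξ : ℕ → Ω → ℂ) (n : ℕ) (ω : Ω) (z : ℂ) : ℂ :=
  ∑ k ∈ Finset.range (n + 1), (b k : ℂ) * ξ k ω * z ^ k

/-- The rescaled polynomial `u ↦ P_n(exp(iψ + u/n)) / (b(n) √n)`, as an element of `𝒜(ℂ)`. -/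
def rescaledPoly {Ω : Type*} (b : ℝ → ℝ) (ξ : ℕ → Ω → ℂ) (ψ : ℝ) (n : ℕ) (ω : Ω) : Entire :=
  ⟨⟨fun u : ℂ => randPoly b ξ n ω (Complex.exp (Complex.I * ψ + u / n)) /
      ((b n * √(n : ℝ) : ℝ) : ℂ), by unfold randPoly; fun_prop⟩,
    by simp only [ContinuousMap.coe_mk]; unfold randPoly; fun_prop⟩

/-- The kernel `∫_0^1 x^{2α} e^{x w} dx`. -/
def kernel (α : ℝ) (w : ℂ) : ℂ :=
  ∫ x in (0 : ℝ)..1, ((x ^ (2 * α) : ℝ) : ℂ) * Complex.exp (x * w)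

/-- The random element `G = (G_{ψ_1}, …, G_{ψ_m})` of `𝒜(ℂ)^m` is centred and jointly (complex, not
necessarily circular) Gaussian, that is, all its finite-dimensional distributions are Gaussian, and
it has the prescribed covariances `E[G_i(u) conj(G_j(v))]` and pseudo-covariances
`E[G_i(u) G_j(v)]`.  Here `s₁` and `s₂` are the variances `σ₁²` and `σ₂²` of the real and imaginary
parts of `ξ`. -/
structure IsGaussianLimit {Ω' : Type*} [MeasurableSpace Ω'] (α s₁ s₂ : ℝ) {m : ℕ}
    (ψ : Fin m → ℝ) (G : Ω' → Fin m → Entire) (μ : Measure Ω') : Prop where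
  measurable : Measurable G
  gaussian : IsGaussianProcess (fun (p : Fin m × ℂ) (ω : Ω') => G ω p.1 p.2) μ
  centered : ∀ j u, ∫ ω, G ω j u ∂μ = 0
  /-- covariance of `G_{ψ_j}` -/
  cov_self : ∀ j u v, ∫ ω, G ω j u * starRingEnd ℂ (G ω j v) ∂μ =
    ((s₁ + s₂ : ℝ) : ℂ) * kernel α (u + starRingEnd ℂ v)
  /-- pseudo-covariance of `G_{ψ_j}`, for `ψ_j ∈ {0, π}` -/
  pcov_self_real : ∀ j u v, (ψ j = 0 ∨ ψ j = Real.pi) →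
    ∫ ω, G ω j u * G ω j v ∂μ = ((s₁ - s₂ : ℝ) : ℂ) * kernel α (u + v)
  /-- pseudo-covariance of `G_{ψ_j}`, for `ψ_j ∈ (0, π) ∪ (π, 2π)` -/
  pcov_self_nonreal : ∀ j u v, ψ j ≠ 0 → ψ j ≠ Real.pi → ∫ ω, G ω j u * G ω j v ∂μ = 0
  /-- cross-covariances -/
  cov_cross : ∀ i j, i ≠ j → ∀ u v, ∫ ω, G ω i u * starRingEnd ℂ (G ω j v) ∂μ = 0
  /-- cross-pseudo-covariances for conjugate points of the unit circle -/
  pcov_cross_conj : ∀ i j, i ≠ j → ψ i + ψ j = 2 * Real.pi → ∀ u v,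
    ∫ ω, G ω i u * G ω j v ∂μ = ((s₁ - s₂ : ℝ) : ℂ) * kernel α (u + v)
  /-- cross-pseudo-covariances for non-conjugate points of the unit circle -/
  pcov_cross_nonconj : ∀ i j, i ≠ j → ψ i + ψ j ≠ 2 * Real.pi → ∀ u v,
    ∫ ω, G ω i u * G ω j v ∂μ = 0

end LiquidPhase

end

/-!
A finite family of values of the rescaled polynomials is a weighted sum of the i.i.d. variables
`ξ k`, and the values at different points interact only through sums of the form
`∑_{k ≤ n} b(k)² / (b(n)² n) f(k/n) z ^ k` with `z` on the unit circle, where `z` is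
`e^{i(ψ_i - ψ_j)}` for the covariances and `e^{i(ψ_i + ψ_j)}` for the pseudo-covariances. Regular
variation turns such a sum into a Riemann sum for `∫_0^1 x^{2α} f(x) dx` if `z = 1`; if `z ≠ 1` it
oscillates and tends to `0` (`IsRegularlyVarying.tendsto_sum_sq_div`). The uniform convergence
theorem and the Potter bounds for slowly varying functions provide the pointwise limit
(`IsRegularlyVarying.tendsto_div`) and the integrable domination
(`IsRegularlyVarying.exists_sq_div_sq_le`, where `α > -1/2` is used). The same bounds show that the
weights are uniformly negligible, so the central limit theorem `tendsto_integral_exp_re_sum` gives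
convergence of the characteristic functions of all real linear functionals of finitely many values
(`tendsto_integral_exp_reSum_rescaledPoly`).

For tightness, the derivatives at `0` of the rescaled polynomials are bounded in `L²`, uniformly in
the order of the derivative, so that with high probability the `p`-th derivative is at most `A 2^p`
for all `p`; the entire functions with such derivatives form a compact set
(`Entire.isCompact_range_ofCoeff`, `exists_isTightMeasureSet_rescaledPoly`).

By Prokhorov's theorem a tight sequence has cluster points, and a law on `𝒜(ℂ)^m` is determined by
the characteristic functions above, because evaluations generate the Borel `σ`-algebra
(`Entire.measurable_iff`, `ext_of_integral_exp_reSum`). Hence the limit law exists and is unique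
(`exists_and_tendsto_of_tight`). A random element has these limiting characteristic functions
exactly when it is centred Gaussian with the prescribed covariances
(`IsGaussianLimit.integral_exp_reSum`, `isGaussianLimit_of_integral_exp_reSum`), which gives
existence and convergence at once.
-/

/-! ### Regular variation -/

namespace LiquidPhase

/-- **Uniform convergence theorem** for slowly varying functions, in additive form: if `h` is
measurable and `h (t + s) - h t → 0` as `t → ∞` for each fixed `s`, then the convergence is
uniform for `s ∈ [0, 1]`. -/
theorem eventually_abs_sub_lt_of_tendsto_sub {h : ℝ → ℝ} (hm : Measurable h)
    (hlim : ∀ s, Tendsto (fun t => h (t + s) - h t) atTop (𝓝 0)) {ε : ℝ} (hε : 0 < ε) :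
    ∃ T : ℝ, ∀ t ≥ T, ∀ s ∈ Set.Icc (0 : ℝ) 1, |h (t + s) - h t| < ε := by
  -- `B t` collects the shifts that are bad at `t`; its measure tends to `0`.
  let B : ℝ → Set ℝ := fun t => {s | s ∈ Set.Icc (0 : ℝ) 2 ∧ ε / 2 ≤ |h (t + s) - h t|}
  have hBm : ∀ t, MeasurableSet (B t) := fun t =>
    measurableSet_Icc.inter (measurableSet_le (f := fun _ => ε / 2)
      (g := fun s => |h (t + s) - h t|) measurable_const (by fun_prop))
  have hB : Tendsto (fun t => volume (B t)) atTop (𝓝 0) := by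
    have := tendsto_measure_of_tendsto_indicator (μ := (volume : Measure ℝ)) (L := atTop)
      (A := ∅) (As := B) (B := Set.Icc (0 : ℝ) 2) hBm
      measurableSet_Icc (by simp) (Eventually.of_forall fun t s hs => hs.1) ?_
    · simpa using this
    · intro s
      have h1 : ∀ᶠ t in atTop, |h (t + s) - h t| < ε / 2 := by
        have := (hlim s).abs
        rw [abs_zero] at this
        exact this.eventually_lt_const (half_pos hε)
      filter_upwards [h1] with t ht
      simp [B, ht]
  obtain ⟨T, hT⟩ := eventually_atTop.1
    (hB.eventually_lt_const (show (0 : ENNReal) < 1 / 2 by simp))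
  refine ⟨T, fun t ht s hs => ?_⟩
  -- a shift `y` that is good at `t` and for which `y - s` is good at `t + s`
  obtain ⟨y, hy, hy1, hy2⟩ : ∃ y ∈ Set.Icc s 2, y ∉ B t ∧ y - s ∉ B (t + s) := by
    -- otherwise the bad sets, of measure less than `1/2` each, cover `[s, 2]`
    by_contra! hcon
    have hsub : Set.Icc s 2 ⊆ B t ∪ (fun y => y - s) ⁻¹' B (t + s) := by
      intro y hy
      by_cases hyB : y ∈ B t
      · exact Or.inl hyB
      · exact Or.inr (hcon y hy hyB)
    have h1 : volume (Set.Icc s 2) < 1 := calc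
      volume (Set.Icc s 2) ≤ volume (B t) + volume ((fun y => y - s) ⁻¹' B (t + s)) :=
        (measure_mono hsub).trans (measure_union_le _ _)
      _ = volume (B t) + volume (B (t + s)) := by
        simp_rw [sub_eq_add_neg, measure_preimage_add_right]
      _ < 1 / 2 + 1 / 2 := ENNReal.add_lt_add (hT t ht) (hT _ (by linarith [hs.1]))
      _ = 1 := by simp [ENNReal.inv_two_add_inv_two]
    rw [Real.volume_Icc, ENNReal.ofReal_lt_one] at h1
    linarith [hs.2]
  have h1 : |h (t + y) - h t| < ε / 2 := by
    by_contra! hc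
    exact hy1 ⟨⟨hs.1.trans hy.1, hy.2⟩, hc⟩
  have h2 : |h (t + y) - h (t + s)| < ε / 2 := by
    by_contra! hc
    refine hy2 ⟨⟨by linarith [hy.1], by linarith [hy.2, hs.1]⟩, ?_⟩
    rwa [show t + s + (y - s) = t + y by ring]
  rw [abs_lt] at *
  constructor <;> linarith [h1.1, h1.2, h2.1, h2.2]

/-- An additive form of the **Potter bounds**: `h` grows slower than any linear function. -/
theorem exists_abs_sub_le_of_tendsto_sub {h : ℝ → ℝ} (hm : Measurable h)
    (hlim : ∀ s, Tendsto (fun t => h (t + s) - h t) atTop (𝓝 0)) {ε : ℝ} (hε : 0 < ε) :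
    ∃ T : ℝ, ∀ t ≥ T, ∀ t' ≥ T, |h t' - h t| ≤ ε * (|t' - t| + 1) := by
  obtain ⟨T, hT⟩ := eventually_abs_sub_lt_of_tendsto_sub hm hlim hε
  have key : ∀ t ≥ T, ∀ n : ℕ, ∀ r ∈ Set.Icc (0 : ℝ) n, |h (t + r) - h t| ≤ ε * n := by
    intro t ht n
    induction n with
    | zero =>
      intro r hr
      have : r = 0 := le_antisymm (by simpa using hr.2) hr.1
      simp [this]
    | succ n ih =>
      intro r hr
      rcases le_total r n with hrn | hrn
      · refine (ih r ⟨hr.1, hrn⟩).trans ?_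
        push_cast
        nlinarith
      · have h1 := ih n ⟨by positivity, le_rfl⟩
        have h2 := hT (t + n) (by linarith [(Nat.cast_nonneg n : (0 : ℝ) ≤ n)]) (r - n)
          ⟨by linarith, by have := hr.2; push_cast at this; linarith⟩
        rw [show t + n + (r - n) = t + r by ring] at h2
        push_cast
        rw [abs_le] at *
        rw [abs_lt] at h2
        constructor <;> linarith [h1.1, h1.2, h2.1, h2.2]
  have mono : ∀ t ≥ T, ∀ t' ≥ t, |h t' - h t| ≤ ε * (|t' - t| + 1) := by
    intro t ht t' htt'
    have h1 := key t ht ⌈t' - t⌉₊ (t' - t) ⟨by linarith, Nat.le_ceil _⟩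
    rw [show t + (t' - t) = t' by ring] at h1
    refine h1.trans ?_
    gcongr
    rw [abs_of_nonneg (by linarith)]
    exact (Nat.ceil_lt_add_one (by linarith)).le
  refine ⟨T, fun t ht t' ht' => ?_⟩
  rcases le_total t t' with h1 | h1
  · exact mono t ht t' h1
  · rw [abs_sub_comm, abs_sub_comm t']
    exact mono t' ht' t h1

variable {b ℓ : ℝ → ℝ} {α : ℝ}

/-- **Potter bounds** for a slowly varying function. -/
theorem IsSlowlyVarying.exists_abs_log_sub_le (hℓ : IsSlowlyVarying ℓ) {ε : ℝ} (hε : 0 < ε) :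
    ∃ X : ℝ, 0 < X ∧ (∀ x ≥ X, 0 < ℓ x) ∧ ∀ x ≥ X, ∀ y ≥ X,
      |Real.log (ℓ y) - Real.log (ℓ x)| ≤ ε * (|Real.log y - Real.log x| + 1) := by
  set h : ℝ → ℝ := fun t => Real.log (ℓ (Real.exp t)) with hh
  have hm : Measurable h := by
    have : h = fun t =>
        Real.log ((fun x : Set.Ioi (0 : ℝ) => ℓ x) ⟨Real.exp t, Real.exp_pos t⟩) := rfl
    rw [this]
    exact Real.measurable_log.comp
      (hℓ.measurable.comp (Real.measurable_exp.subtype_mk))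
  have hlim : ∀ s, Tendsto (fun t => h (t + s) - h t) atTop (𝓝 0) := by
    intro s
    have h1 := (hℓ.tendsto_ratio (Real.exp s) (Real.exp_pos s)).comp Real.tendsto_exp_atTop
    have h2 := (Real.continuousAt_log one_ne_zero).tendsto.comp h1
    rw [Real.log_one] at h2
    have hpos := Real.tendsto_exp_atTop.eventually hℓ.eventually_pos
    have hpos' : ∀ᶠ t in atTop, 0 < ℓ (Real.exp (t + s)) :=
      (tendsto_atTop_add_const_right atTop s tendsto_id).eventually hpos
    refine h2.congr' ?_
    filter_upwards [hpos, hpos'] with t ht ht'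
    simp only [Function.comp, hh]
    rw [← Real.exp_add, add_comm s t, Real.log_div ht'.ne' ht.ne']
  obtain ⟨T, hT⟩ := exists_abs_sub_le_of_tendsto_sub hm hlim hε
  obtain ⟨X, hX⟩ := eventually_atTop.1 hℓ.eventually_pos
  have hXpos : 0 < max X (Real.exp T) := lt_max_of_lt_right (Real.exp_pos T)
  refine ⟨max X (Real.exp T), hXpos, fun x hx => hX x ((le_max_left _ _).trans hx),
    fun x hx y hy => ?_⟩
  have hlog : ∀ z ≥ max X (Real.exp T), 0 < z ∧ T ≤ Real.log z := fun z hz =>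
    ⟨hXpos.trans_le hz, (Real.le_log_iff_exp_le (hXpos.trans_le hz)).2
      ((le_max_right _ _).trans hz)⟩
  have := hT _ (hlog x hx).2 _ (hlog y hy).2
  simpa only [hh, Real.exp_log (hlog x hx).1, Real.exp_log (hlog y hy).1] using this

/-- The locally uniform form of regular variation, along integers: `b(k)/b(n) → x ^ α` when
`k / n → x > 0`. -/
theorem IsRegularlyVarying.tendsto_div (hb : IsRegularlyVarying b α) {k : ℕ → ℕ} {x : ℝ}
    (hx : 0 < x) (hk : Tendsto (fun n : ℕ => (k n : ℝ) / n) atTop (𝓝 x)) :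
    Tendsto (fun n : ℕ => b (k n) / b n) atTop (𝓝 (x ^ α)) := by
  obtain ⟨ℓ, hℓ, hbℓ⟩ := hb
  have hn : Tendsto (fun n : ℕ => (n : ℝ)) atTop atTop := tendsto_natCast_atTop_atTop
  have hkn : Tendsto (fun n : ℕ => (k n : ℝ)) atTop atTop := by
    refine (hk.pos_mul_atTop hx hn).congr' ?_
    filter_upwards [eventually_gt_atTop 0] with n hn0
    field_simp
  have hlogk : Tendsto (fun n : ℕ => Real.log (k n) - Real.log n) atTop (𝓝 (Real.log x)) := by
    refine ((Real.continuousAt_log hx.ne').tendsto.comp hk).congr' ?_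
    filter_upwards [hn.eventually_gt_atTop 0, hkn.eventually_gt_atTop 0] with n h1 h2
    exact Real.log_div h2.ne' h1.ne'
  have hlogℓ : Tendsto (fun n : ℕ => Real.log (ℓ (k n)) - Real.log (ℓ n)) atTop (𝓝 0) := by
    rw [Metric.tendsto_atTop']
    intro ε hε
    set R := |Real.log x| + 1
    have hR : 0 < R + 1 := by positivity
    obtain ⟨X, -, -, hX⟩ := hℓ.exists_abs_log_sub_le (ε := ε / (2 * (R + 1))) (by positivity)
    have h1 : ∀ᶠ n : ℕ in atTop, |Real.log (k n) - Real.log n| < R :=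
      hlogk.abs.eventually_lt_const (by simp [R])
    obtain ⟨N, hN⟩ := eventually_atTop.1
      ((h1.and (hn.eventually_ge_atTop X)).and (hkn.eventually_ge_atTop X))
    refine ⟨N, fun n hn => ?_⟩
    obtain ⟨⟨h2, h3⟩, h4⟩ := hN n hn.le
    rw [dist_zero_right, Real.norm_eq_abs]
    calc _ ≤ ε / (2 * (R + 1)) * (|Real.log (k n) - Real.log n| + 1) := hX _ h3 _ h4
      _ ≤ ε / (2 * (R + 1)) * (R + 1) := by gcongr
      _ = ε / 2 := by field_simp
      _ < ε := half_lt_self hε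
  have hratio : Tendsto (fun n : ℕ => ℓ (k n) / ℓ n) atTop (𝓝 1) := by
    have := (Real.continuous_exp.tendsto 0).comp hlogℓ
    rw [Real.exp_zero] at this
    refine this.congr' ?_
    filter_upwards [hn.eventually hℓ.eventually_pos, hkn.eventually hℓ.eventually_pos]
      with n h1 h2
    simp only [Function.comp]
    rw [Real.exp_sub, Real.exp_log h1, Real.exp_log h2]
  have hpow := hk.rpow_const (p := α) (Or.inl hx.ne')
  have := hpow.mul hratio
  rw [mul_one] at this
  refine this.congr' ?_
  filter_upwards [hn.eventually_gt_atTop 0, hkn.eventually_gt_atTop 0] with n h1 h2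
  rw [hbℓ _ h1, hbℓ _ h2, Real.div_rpow h2.le h1.le, div_mul_div_comm]

theorem IsRegularlyVarying.eventually_pos (hb : IsRegularlyVarying b α) :
    ∀ᶠ n : ℕ in atTop, 0 < b n := by
  obtain ⟨ℓ, hℓ, hbℓ⟩ := hb
  have hn : Tendsto (fun n : ℕ => (n : ℝ)) atTop atTop := tendsto_natCast_atTop_atTop
  filter_upwards [hn.eventually hℓ.eventually_pos, hn.eventually_gt_atTop 0] with n h1 h2
  rw [hbℓ _ h2]
  positivity

/-- Domination of the squared ratios by an integrable power: `α > -1/2` leaves room for an exponent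
`β ∈ (-1, 0)` below `2α`, and the Potter bounds absorb the slowly varying factor.  For `k` below
the threshold of these bounds the ratio is compared through the threshold itself. -/
theorem IsRegularlyVarying.exists_sq_div_sq_le (hb : IsRegularlyVarying b α)
    (hα : -1 / 2 < α) :
    ∃ β C : ℝ, ∃ N : ℕ, -1 < β ∧ β < 0 ∧ 0 < C ∧ 0 < N ∧ ∀ n ≥ N, 0 < b n ∧
      1 / b n ^ 2 ≤ C * (n : ℝ) ^ (-β) ∧
      ∀ k : ℕ, 1 ≤ k → k ≤ n → b k ^ 2 / b n ^ 2 ≤ C * ((k : ℝ) / n) ^ β := by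
  have hpos := hb.eventually_pos
  obtain ⟨ℓ, hℓ, hbℓ⟩ := hb
  set ε := (2 * α + 1) / 4 with hε
  have hε0 : 0 < ε := by rw [hε]; linarith
  -- capping `β` at `-1/2` makes it negative, so that `y ↦ y ^ β` is antitone for every `α`
  set β := min (2 * α - 2 * ε) (-1 / 2) with hβ
  have hβ1 : -1 < β := lt_min (by rw [hε]; linarith) (by norm_num)
  have hβ0 : β < 0 := (min_le_right _ _).trans_lt (by norm_num)
  obtain ⟨X, hX0, hXpos, hX⟩ := hℓ.exists_abs_log_sub_le hε0
  obtain ⟨K, hK⟩ := eventually_atTop.1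
    ((hpos.and (tendsto_natCast_atTop_atTop.eventually_ge_atTop X)).and (eventually_gt_atTop 0))
  have hK0 : 0 < K := (hK K le_rfl).2
  have hbK : 0 < b K := (hK K le_rfl).1.1
  -- Potter bounds above the threshold `K`
  have main : ∀ k n : ℕ, K ≤ k → k ≤ n →
      b k ^ 2 / b n ^ 2 ≤ Real.exp (2 * ε) * ((k : ℝ) / n) ^ β := by
    intro k n hKk hkn
    have hk0 : (0 : ℝ) < k := by exact_mod_cast hK0.trans_le hKk
    have hn0 : (0 : ℝ) < n := hk0.trans_le (by exact_mod_cast hkn)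
    have hkX := (hK k hKk).1.2
    have hnX := (hK n (hKk.trans hkn)).1.2
    have hlogle : Real.log k ≤ Real.log n := Real.log_le_log hk0 (by exact_mod_cast hkn)
    have h1 := (abs_le.1 (hX _ hnX _ hkX)).2
    rw [abs_of_nonpos (by linarith)] at h1
    have hq : (0 : ℝ) < k / n := by positivity
    have hq1 : (k : ℝ) / n ≤ 1 := (div_le_one hn0).2 (by exact_mod_cast hkn)
    have h2 : b k ^ 2 / b n ^ 2 ≤ Real.exp (2 * ε) * ((k : ℝ) / n) ^ (2 * α - 2 * ε) := by
      have e1 : b k ^ 2 / b n ^ 2 =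
          Real.exp (2 * α * (Real.log k - Real.log n) +
            2 * (Real.log (ℓ k) - Real.log (ℓ n))) := by
        have e2 : ∀ y : ℝ, 0 < y → 0 < ℓ y → b y ^ 2 =
            Real.exp (2 * α * Real.log y + 2 * Real.log (ℓ y)) := by
          intro y hy hly
          rw [hbℓ y hy, Real.exp_add, mul_pow, two_mul (Real.log _), Real.exp_add,
            Real.exp_log hly, Real.rpow_def_of_pos hy, ← Real.exp_nat_mul, sq (ℓ y)]
          congr 2
          push_cast
          ring
        rw [e2 _ hk0 (hXpos _ hkX), e2 _ hn0 (hXpos _ hnX), ← Real.exp_sub]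
        congr 1
        ring
      rw [e1, Real.rpow_def_of_pos hq, ← Real.exp_add, Real.log_div hk0.ne' hn0.ne']
      apply Real.exp_le_exp.2
      nlinarith
    exact h2.trans (mul_le_mul_of_nonneg_left
      (Real.rpow_le_rpow_of_exponent_ge hq hq1 (min_le_left _ _)) (Real.exp_pos _).le)
  -- comparison through `K` below the threshold
  set M := 1 + ∑ k ∈ Finset.range K, b k ^ 2 / b K ^ 2 with hM
  have hM1 : 1 ≤ M := by
    rw [hM]
    have : 0 ≤ ∑ k ∈ Finset.range K, b k ^ 2 / b K ^ 2 := Finset.sum_nonneg fun _ _ => by positivity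
    linarith
  have hM2 : ∀ k < K, b k ^ 2 / b K ^ 2 ≤ M := by
    intro k hk
    have := Finset.single_le_sum (f := fun k : ℕ => b k ^ 2 / b K ^ 2)
      (fun i _ => by positivity) (Finset.mem_range.2 hk)
    linarith
  have hinv : ∀ n ≥ K, 1 / b n ^ 2 ≤ (1 / b K ^ 2 * Real.exp (2 * ε)) * (n : ℝ) ^ (-β) := by
    intro n hn
    have hn0 : (0 : ℝ) < n := by exact_mod_cast hK0.trans_le hn
    have h1 := main K n le_rfl hn
    have hKR : (1 : ℝ) ≤ K := by exact_mod_cast hK0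
    have h2 : ((K : ℝ) / n) ^ β ≤ (n : ℝ) ^ (-β) := by
      rw [Real.div_rpow (by positivity) hn0.le, Real.rpow_neg hn0.le, div_eq_mul_inv]
      have : (K : ℝ) ^ β ≤ 1 := Real.rpow_le_one_of_one_le_of_nonpos hKR hβ0.le
      exact mul_le_of_le_one_left (by positivity) this
    calc 1 / b n ^ 2 = 1 / b K ^ 2 * (b K ^ 2 / b n ^ 2) := by field_simp
      _ ≤ 1 / b K ^ 2 * (Real.exp (2 * ε) * (n : ℝ) ^ (-β)) := by
        gcongr
        exact h1.trans (by gcongr)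
      _ = _ := by ring
  set C := max (M * Real.exp (2 * ε)) (1 / b K ^ 2 * Real.exp (2 * ε)) with hC
  refine ⟨β, C, K, hβ1, hβ0, lt_max_of_lt_left (by positivity), hK0, fun n hn =>
    ⟨(hK n hn).1.1, (hinv n hn).trans (by gcongr; exact le_max_right _ _), fun k hk1 hkn => ?_⟩⟩
  have hn0 : (0 : ℝ) < n := by exact_mod_cast hK0.trans_le hn
  have hk0 : (0 : ℝ) < k := by exact_mod_cast hk1
  refine le_trans ?_ (mul_le_mul_of_nonneg_right (le_max_left _ _) (by positivity))
  rcases le_or_gt K k with hKk | hkK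
  · refine (main k n hKk hkn).trans ?_
    gcongr
    exact le_mul_of_one_le_left (by positivity) hM1
  · calc b k ^ 2 / b n ^ 2 = (b k ^ 2 / b K ^ 2) * (b K ^ 2 / b n ^ 2) := by field_simp
      _ ≤ M * (Real.exp (2 * ε) * ((K : ℝ) / n) ^ β) := by
        gcongr
        · exact hM2 k hkK
        · exact main K n le_rfl hn
      _ ≤ M * (Real.exp (2 * ε) * ((k : ℝ) / n) ^ β) := by
        gcongr M * (Real.exp (2 * ε) * ?_)
        exact Real.rpow_le_rpow_of_nonpos (by positivity) (by gcongr) hβ0.le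
      _ = _ := by ring

end LiquidPhase

/-! ### Weighted Riemann sums -/

namespace LiquidPhase

/-- A right Riemann sum as the integral of a step function. -/
theorem integral_natCeil_mul {E : Type*} [NormedAddCommGroup E] [NormedSpace ℝ E]
    [CompleteSpace E] (g : ℕ → E) {n : ℕ} (hn : 0 < n) :
    ∫ x in (0 : ℝ)..1, g ⌈(n : ℝ) * x⌉₊ = (n : ℝ)⁻¹ • ∑ k ∈ Finset.range n, g (k + 1) := by
  have hn0 : (n : ℝ) ≠ 0 := by positivity
  rw [intervalIntegral.integral_comp_mul_left (fun y : ℝ => g ⌈y⌉₊) hn0]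
  congr 1
  have hconst : ∀ k : ℕ, ∀ y ∈ Set.uIoc (k : ℝ) ((k + 1 : ℕ) : ℝ), g ⌈y⌉₊ = g (k + 1) := by
    intro k y hy
    rw [Set.uIoc_of_le (by push_cast; linarith)] at hy
    have : ⌈y⌉₊ = k + 1 := (Nat.ceil_eq_iff (by omega)).2 ⟨by simpa using hy.1, hy.2⟩
    rw [this]
  have hint : ∀ k : ℕ, IntervalIntegrable (fun y : ℝ => g ⌈y⌉₊) volume (k : ℝ)
      ((k + 1 : ℕ) : ℝ) := fun k =>
    (intervalIntegrable_const (c := g (k + 1))).congr (fun y hy => (hconst k y hy).symm)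
  have := intervalIntegral.sum_integral_adjacent_intervals (a := fun k : ℕ => (k : ℝ)) (n := n)
    (f := fun y : ℝ => g ⌈y⌉₊) (μ := volume) (fun k _ => hint k)
  simp only [Nat.cast_zero] at this
  rw [mul_zero, mul_one, ← this]
  refine Finset.sum_congr rfl fun k _ => ?_
  rw [intervalIntegral.integral_congr_ae
    (g := fun _ => g (k + 1)) (Eventually.of_forall fun y hy => hconst k y hy)]
  simp

theorem tendsto_natCeil_mul_div {x : ℝ} (hx : 0 < x) :
    Tendsto (fun n : ℕ => (⌈(n : ℝ) * x⌉₊ : ℝ) / n) atTop (𝓝 x) := by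
  have := (tendsto_nat_ceil_mul_div_atTop (R := ℝ) hx.le).comp
    (tendsto_natCast_atTop_atTop (R := ℝ))
  simpa [Function.comp_def, mul_comm x] using this

theorem tendsto_natCeil_mul_sub_one_div {x : ℝ} (hx : 0 < x) :
    Tendsto (fun n : ℕ => ((⌈(n : ℝ) * x⌉₊ - 1 : ℕ) : ℝ) / n) atTop (𝓝 x) := by
  have := (tendsto_natCeil_mul_div hx).sub (tendsto_one_div_atTop_nhds_zero_nat (𝕜 := ℝ))
  rw [sub_zero] at this
  refine this.congr' ?_
  filter_upwards [eventually_gt_atTop 0] with n hn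
  have : 1 ≤ ⌈(n : ℝ) * x⌉₊ := Nat.one_le_ceil_iff.2 (by positivity)
  push_cast [this]
  ring

/-- Summation by parts against a geometric progression. -/
theorem sum_by_parts_geometric (a : ℕ → ℂ) (z : ℂ) (n : ℕ) :
    (1 - z) * ∑ k ∈ Finset.range n, a (k + 1) * z ^ (k + 1) =
      ∑ k ∈ Finset.range n, (a (k + 1) - a k) * z ^ (k + 1) + a 0 * z - a n * z ^ (n + 1) := by
  induction n with
  | zero => simp
  | succ n ih =>
    rw [Finset.sum_range_succ, Finset.sum_range_succ, mul_add, ih]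
    ring

/-- Dominated convergence for triangular arrays `a n k`, `1 ≤ k ≤ n`, that converge to `g x` along
`k / n → x` and are dominated by an integrable power of `k / n`.  The averages of `a n k * z ^ k`
converge to the integral of `g` for `z = 1`; for the other points of the unit circle they cancel,
because summation by parts turns `a n k` into the increments `a n k - a n (k - 1)`, whose limit
is `g x - g x = 0`. -/
theorem tendsto_average_mul_pow {a : ℕ → ℕ → ℂ} {g : ℝ → ℂ} {β C : ℝ} {N : ℕ}
    (hβ : -1 < β) (hβ0 : β < 0) (hC : 0 < C) (ha0 : ∀ n, a n 0 = 0)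
    (ha : ∀ n ≥ N, ∀ k : ℕ, 1 ≤ k → k ≤ n → ‖a n k‖ ≤ C * ((k : ℝ) / n) ^ β)
    (hlim : ∀ x : ℝ, 0 < x → ∀ k : ℕ → ℕ, Tendsto (fun n : ℕ => (k n : ℝ) / n) atTop (𝓝 x) →
      Tendsto (fun n => a n (k n)) atTop (𝓝 (g x)))
    {z : ℂ} (hz : ‖z‖ = 1) :
    Tendsto (fun n : ℕ => (n : ℝ)⁻¹ • ∑ k ∈ Finset.range n, a n (k + 1) * z ^ (k + 1)) atTop
      (𝓝 (if z = 1 then ∫ x in (0 : ℝ)..1, g x else 0)) := by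
  have hmeas : ∀ (n : ℕ) (h : ℕ → ℂ), Measurable fun x : ℝ => h ⌈(n : ℝ) * x⌉₊ := fun n h =>
    (measurable_from_nat (f := h)).comp (Nat.measurable_ceil.comp (measurable_const_mul _))
  -- `⌈n x⌉` and, unless it vanishes, `⌈n x⌉ - 1` are at least `n x / 2`, which gives a bound that
  -- does not depend on `n`
  have hmain : ∀ n ≥ N, 0 < n → ∀ x ∈ Set.Ioc (0 : ℝ) 1,
      ‖a n ⌈(n : ℝ) * x⌉₊‖ ≤ C * (x / 2) ^ β ∧
      ‖a n (⌈(n : ℝ) * x⌉₊ - 1)‖ ≤ C * (x / 2) ^ β := by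
    intro n hn hn0 x hx
    have hn1 : (0 : ℝ) < n := by exact_mod_cast hn0
    have key : ∀ k : ℕ, k ≤ n → (1 ≤ k → n * x ≤ 2 * k) → ‖a n k‖ ≤ C * (x / 2) ^ β := by
      intro k hkn hk
      rcases Nat.eq_zero_or_pos k with rfl | hk1
      · rw [ha0, norm_zero]
        have := hx.1
        positivity
      · refine (ha n hn k hk1 hkn).trans ?_
        gcongr C * ?_
        refine Real.rpow_le_rpow_of_nonpos (by linarith [hx.1]) ?_ hβ0.le
        rw [div_le_div_iff₀ two_pos hn1]
        linarith [hk hk1]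
    have hle : ⌈(n : ℝ) * x⌉₊ ≤ n := Nat.ceil_le.2 (mul_le_of_le_one_right hn1.le hx.2)
    have hge := Nat.le_ceil ((n : ℝ) * x)
    refine ⟨key _ hle fun _ => ?_, key _ (by omega) fun hk1 => ?_⟩
    · have : (0 : ℝ) ≤ ⌈(n : ℝ) * x⌉₊ := Nat.cast_nonneg _
      linarith
    · have h1 : (1 : ℝ) ≤ ((⌈(n : ℝ) * x⌉₊ - 1 : ℕ) : ℝ) := by exact_mod_cast hk1
      rw [Nat.cast_sub (by omega)] at h1 ⊢
      push_cast at h1 ⊢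
      linarith
  have hint : ∀ D : ℝ, IntervalIntegrable (fun x : ℝ => D * (x / 2) ^ β) volume 0 1 := by
    intro D
    have h1 := (intervalIntegral.intervalIntegrable_rpow' (a := 0) (b := 1) hβ).const_mul
      (D * (2 ^ β)⁻¹)
    refine h1.congr fun x hx => ?_
    rw [Set.uIoc_of_le zero_le_one] at hx
    rw [Real.div_rpow hx.1.le zero_le_two]
    ring
  split_ifs with h1
  · subst h1
    have := intervalIntegral.tendsto_integral_filter_of_dominated_convergence
      (μ := volume) (l := atTop) (a := 0) (b := 1)
      (F := fun (n : ℕ) (x : ℝ) => a n ⌈(n : ℝ) * x⌉₊) (f := g)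
      (fun x => C * (x / 2) ^ β) (Eventually.of_forall fun n => (hmeas n _).aestronglyMeasurable)
      ?_ (hint C) ?_
    · refine this.congr' ?_
      filter_upwards [eventually_gt_atTop 0] with n hn
      rw [integral_natCeil_mul _ hn]
      simp
    · filter_upwards [eventually_ge_atTop N, eventually_gt_atTop 0] with n hn hn0
      refine Eventually.of_forall fun x hx => ?_
      rw [Set.uIoc_of_le zero_le_one] at hx
      exact (hmain n hn hn0 x hx).1
    · refine Eventually.of_forall fun x hx => ?_
      rw [Set.uIoc_of_le zero_le_one] at hx
      exact hlim x hx.1 _ (tendsto_natCeil_mul_div hx.1)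
  · have hz1 : 1 - z ≠ 0 := sub_ne_zero.2 (Ne.symm h1)
    -- the total variation of the array along `k` is negligible
    have hvar : Tendsto (fun n : ℕ => (n : ℝ)⁻¹ * ∑ k ∈ Finset.range n, ‖a n (k + 1) - a n k‖)
        atTop (𝓝 0) := by
      have := intervalIntegral.tendsto_integral_filter_of_dominated_convergence
        (μ := volume) (l := atTop) (a := 0) (b := 1)
        (F := fun (n : ℕ) (x : ℝ) => ‖a n ⌈(n : ℝ) * x⌉₊ - a n (⌈(n : ℝ) * x⌉₊ - 1)‖)
        (f := fun _ => (0 : ℝ))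
        (fun x => 2 * C * (x / 2) ^ β) (Eventually.of_forall fun n =>
          (hmeas n (fun k => a n k - a n (k - 1))).norm.aestronglyMeasurable)
        ?_ (hint _) ?_
      · rw [intervalIntegral.integral_zero] at this
        refine this.congr' ?_
        filter_upwards [eventually_gt_atTop 0] with n hn
        rw [integral_natCeil_mul (fun k => ‖a n k - a n (k - 1)‖) hn]
        simp
      · filter_upwards [eventually_ge_atTop N, eventually_gt_atTop 0] with n hn hn0
        refine Eventually.of_forall fun x hx => ?_
        rw [Set.uIoc_of_le zero_le_one] at hx
        rw [norm_norm]
        have := hmain n hn hn0 x hx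
        linarith [norm_sub_le (a n ⌈(n : ℝ) * x⌉₊) (a n (⌈(n : ℝ) * x⌉₊ - 1)), this.1, this.2]
      · refine Eventually.of_forall fun x hx => ?_
        rw [Set.uIoc_of_le zero_le_one] at hx
        have := ((hlim x hx.1 _ (tendsto_natCeil_mul_div hx.1)).sub
          (hlim x hx.1 _ (tendsto_natCeil_mul_sub_one_div hx.1))).norm
        simpa using this
    have hend : Tendsto (fun n : ℕ => (n : ℝ)⁻¹ * ‖a n n‖) atTop (𝓝 0) := by
      have hnn : Tendsto (fun n : ℕ => ((n : ℕ) : ℝ) / n) atTop (𝓝 1) := by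
        refine tendsto_const_nhds.congr' ?_
        filter_upwards [eventually_gt_atTop 0] with n hn
        rw [div_self (by positivity)]
      have := (tendsto_inv_atTop_nhds_zero_nat (𝕜 := ℝ)).mul (hlim 1 one_pos _ hnn).norm
      simpa using this
    have hsum := (hvar.add hend).const_mul ‖1 - z‖⁻¹
    rw [add_zero, mul_zero] at hsum
    refine squeeze_zero_norm (fun n => ?_) hsum
    have hparts := sum_by_parts_geometric (a n) z n
    rw [ha0, zero_mul, add_zero] at hparts
    have hpow : ∀ k : ℕ, ‖z ^ k‖ = 1 := fun k => by rw [norm_pow, hz, one_pow]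
    have hle : ‖1 - z‖ * ‖∑ k ∈ Finset.range n, a n (k + 1) * z ^ (k + 1)‖ ≤
        ∑ k ∈ Finset.range n, ‖a n (k + 1) - a n k‖ + ‖a n n‖ := by
      rw [← norm_mul, hparts]
      refine (norm_sub_le _ _).trans (add_le_add ((norm_sum_le _ _).trans ?_) ?_)
      · simp [hpow]
      · simp [hpow]
    rw [norm_smul, norm_inv, Real.norm_natCast, ← mul_add, inv_mul_eq_div ‖1 - z‖,
      le_div_iff₀ (norm_pos_iff.2 hz1)]
    calc _ = (n : ℝ)⁻¹ * (‖1 - z‖ * ‖∑ k ∈ Finset.range n, a n (k + 1) * z ^ (k + 1)‖) := by ring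
      _ ≤ _ := by gcongr

variable {b : ℝ → ℝ} {α : ℝ}

theorem IsRegularlyVarying.tendsto_inv_sq_mul (hb : IsRegularlyVarying b α) (hα : -1 / 2 < α) :
    Tendsto (fun n : ℕ => 1 / (b n ^ 2 * n)) atTop (𝓝 0) := by
  obtain ⟨β, C, N, hβ, hβ0, hC, hN, h⟩ := hb.exists_sq_div_sq_le hα
  have h1 : Tendsto (fun n : ℕ => C * (n : ℝ) ^ (-(1 + β))) atTop (𝓝 (C * 0)) :=
    ((tendsto_rpow_neg_atTop (by linarith)).comp tendsto_natCast_atTop_atTop).const_mul C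
  rw [mul_zero] at h1
  refine squeeze_zero' (Eventually.of_forall fun n => by positivity) ?_ h1
  filter_upwards [eventually_ge_atTop N] with n hn
  have hn0 : (0 : ℝ) < n := by exact_mod_cast hN.trans_le hn
  calc 1 / (b n ^ 2 * n) = 1 / b n ^ 2 * (n : ℝ)⁻¹ := by field_simp
    _ ≤ C * (n : ℝ) ^ (-β) * (n : ℝ)⁻¹ := by gcongr; exact (h n hn).2.1
    _ = C * (n : ℝ) ^ (-(1 + β)) := by
      rw [mul_assoc, ← Real.rpow_neg_one, ← Real.rpow_add hn0]
      ring_nf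

/-- The weights `b(k)² / (b(n)² n)` are uniformly negligible. -/
theorem IsRegularlyVarying.eventually_sq_div_le (hb : IsRegularlyVarying b α) (hα : -1 / 2 < α)
    {ε : ℝ} (hε : 0 < ε) :
    ∀ᶠ n : ℕ in atTop, ∀ k ≤ n, b k ^ 2 / (b n ^ 2 * n) ≤ ε := by
  have hz := (hb.tendsto_inv_sq_mul hα).const_mul (b ((0 : ℕ) : ℝ) ^ 2)
  obtain ⟨β, C, N, hβ, hβ0, hC, hN, h⟩ := hb.exists_sq_div_sq_le hα
  have h1 : Tendsto (fun n : ℕ => C * (n : ℝ) ^ (-(1 + β))) atTop (𝓝 (C * 0)) :=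
    ((tendsto_rpow_neg_atTop (by linarith)).comp tendsto_natCast_atTop_atTop).const_mul C
  rw [mul_zero] at h1 hz
  filter_upwards [eventually_ge_atTop N, h1.eventually_le_const hε, hz.eventually_le_const hε]
    with n hn h2 h3 k hk
  have hn0 : (0 : ℝ) < n := by exact_mod_cast hN.trans_le hn
  rcases Nat.eq_zero_or_pos k with rfl | hk1
  · rwa [mul_one_div] at h3
  · refine le_trans ?_ h2
    have hkn : (1 : ℝ) / n ≤ (k : ℝ) / n := by gcongr; exact_mod_cast hk1
    calc b k ^ 2 / (b n ^ 2 * n) = b k ^ 2 / b n ^ 2 * (n : ℝ)⁻¹ := by field_simp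
      _ ≤ C * ((1 : ℝ) / n) ^ β * (n : ℝ)⁻¹ := by
        gcongr
        refine ((h n hn).2.2 k hk1 hk).trans ?_
        gcongr C * ?_
        exact Real.rpow_le_rpow_of_nonpos (by positivity) hkn hβ0.le
      _ = C * (n : ℝ) ^ (-(1 + β)) := by
        rw [one_div, ← Real.rpow_neg_eq_inv_rpow, mul_assoc, ← Real.rpow_neg_one (n : ℝ),
          ← Real.rpow_add hn0]
        ring_nf

/-- The weighted Riemann sums `∑_{k ≤ n} b(k)² / (b(n)² n) f(k/n) z ^ k` on the unit circle: they
converge to an integral for `z = 1` and cancel otherwise. -/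
theorem IsRegularlyVarying.tendsto_sum_sq_div (hb : IsRegularlyVarying b α) (hα : -1 / 2 < α)
    {f : ℝ → ℂ} (hf : Continuous f) {z : ℂ} (hz : ‖z‖ = 1) :
    Tendsto (fun n : ℕ => ∑ k ∈ Finset.range (n + 1),
        ((b k ^ 2 / (b n ^ 2 * n) : ℝ) : ℂ) * f (k / n) * z ^ k) atTop
      (𝓝 (if z = 1 then ∫ x in (0 : ℝ)..1, ((x ^ (2 * α) : ℝ) : ℂ) * f x else 0)) := by
  obtain ⟨β, C, N, hβ, hβ0, hC, hN, h⟩ := hb.exists_sq_div_sq_le hα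
  obtain ⟨F, hF⟩ := (isCompact_Icc (a := (0 : ℝ)) (b := 1)).exists_bound_of_continuousOn
    hf.continuousOn
  have hF1 : ‖f 0‖ ≤ |F| + 1 := by linarith [hF 0 (by simp), le_abs_self F]
  -- the term `k = 0` is negligible but not covered by the domination, so it is split off
  set a : ℕ → ℕ → ℂ := fun n k =>
    if k = 0 then 0 else ((b k ^ 2 / b n ^ 2 : ℝ) : ℂ) * f (k / n) with ha
  have havg := tendsto_average_mul_pow (a := a) (g := fun x => ((x ^ (2 * α) : ℝ) : ℂ) * f x)
    (C := C * (|F| + 1)) (N := N) hβ hβ0 (by positivity) (fun n => by simp [ha]) ?_ ?_ hz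
  · have h0 : Tendsto (fun n : ℕ => ((b ((0 : ℕ) : ℝ) ^ 2 / (b n ^ 2 * n) : ℝ) : ℂ) * f 0)
        atTop (𝓝 0) := by
      have := (hb.tendsto_inv_sq_mul hα).const_mul (b ((0 : ℕ) : ℝ) ^ 2)
      have := ((Complex.continuous_ofReal.tendsto _).comp this).mul_const (f 0)
      simpa [Function.comp_def, div_eq_mul_inv] using this
    have := h0.add havg
    rw [zero_add] at this
    refine this.congr fun n => ?_
    rw [Finset.sum_range_succ', add_comm, Finset.smul_sum]
    congr 1
    · refine Finset.sum_congr rfl fun k _ => ?_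
      simp only [ha, Nat.succ_ne_zero, if_false, Complex.real_smul]
      push_cast
      rw [div_mul_eq_div_div]
      ring
    · simp
  · intro n hn k hk1 hkn
    have hn0 : (0 : ℝ) < n := by exact_mod_cast hN.trans_le hn
    have hk : (k : ℝ) / n ∈ Set.Icc (0 : ℝ) 1 :=
      ⟨by positivity, (div_le_one hn0).2 (by exact_mod_cast hkn)⟩
    simp only [ha, if_neg (Nat.one_le_iff_ne_zero.1 hk1), norm_mul]
    rw [Complex.norm_real, Real.norm_of_nonneg (by positivity)]
    calc _ ≤ C * ((k : ℝ) / n) ^ β * (|F| + 1) := by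
          gcongr
          · exact (h n hn).2.2 k hk1 hkn
          · linarith [hF _ hk, le_abs_self F]
      _ = _ := by ring
  · intro x hx k hk
    have h1 := (hb.tendsto_div hx hk).pow 2
    have h2 : (x ^ α) ^ 2 = x ^ (2 * α) := by
      rw [← Real.rpow_natCast, ← Real.rpow_mul hx.le]
      push_cast
      ring_nf
    rw [h2] at h1
    have h3 := ((Complex.continuous_ofReal.tendsto _).comp h1).mul ((hf.tendsto x).comp hk)
    refine h3.congr' ?_
    filter_upwards [hk.eventually_const_lt hx] with n hn
    have hk0 : k n ≠ 0 := by
      intro h0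
      simp [h0] at hn
    simp only [Function.comp, ha, if_neg hk0, div_pow]

end LiquidPhase

/-! ### The central limit theorem for weighted sums of complex random variables -/

namespace LiquidPhase

/-- The second order Taylor estimate for `exp (i x)`, with an error that is cubic for small `x` and
quadratic for large `x`. -/
theorem norm_exp_I_mul_sub_le (x : ℝ) :
    ‖Complex.exp (Complex.I * x) - 1 - Complex.I * x + (x : ℂ) ^ 2 / 2‖ ≤
      4 * (x ^ 2 * min 1 |x|) := by
  have hnorm : ‖Complex.I * (x : ℂ)‖ = |x| := by simp
  rcases le_total |x| 1 with hx | hx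
  · have h := Complex.exp_bound (x := Complex.I * x) (by rwa [hnorm]) (n := 3) (by norm_num)
    rw [hnorm] at h
    have e : ∑ m ∈ Finset.range 3, (Complex.I * (x : ℂ)) ^ m / m.factorial =
        1 + Complex.I * x - (x : ℂ) ^ 2 / 2 := by
      simp [Finset.sum_range_succ, Nat.factorial, mul_pow]
      ring
    rw [e] at h
    rw [min_eq_right hx]
    calc _ = ‖Complex.exp (Complex.I * x) - (1 + Complex.I * x - (x : ℂ) ^ 2 / 2)‖ := by
          congr 1; ring
      _ ≤ _ := h
      _ ≤ 4 * |x| ^ 3 := by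
          rw [mul_comm]
          gcongr
          norm_num [Nat.factorial]
      _ = 4 * (x ^ 2 * |x|) := by rw [← sq_abs]; ring
  · rw [min_eq_left hx]
    have h1 : ‖Complex.exp (Complex.I * x)‖ = 1 := Complex.norm_exp_I_mul_ofReal x
    have h2 : ‖(x : ℂ) ^ 2 / 2‖ = x ^ 2 / 2 := by simp
    have h3 : |x| ≤ x ^ 2 := by rw [← sq_abs]; nlinarith
    calc _ ≤ ‖Complex.exp (Complex.I * x)‖ + ‖(1 : ℂ)‖ + ‖Complex.I * (x : ℂ)‖ +
          ‖(x : ℂ) ^ 2 / 2‖ :=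
          (norm_add_le _ _).trans (by
            gcongr
            exact (norm_sub_le _ _).trans (by gcongr; exact norm_sub_le _ _))
      _ ≤ _ := by
          rw [h1, h2, hnorm, norm_one]
          nlinarith

theorem norm_prod_sub_prod_le {ι : Type*} (s : Finset ι) (z w : ι → ℂ)
    (hz : ∀ i ∈ s, ‖z i‖ ≤ 1) (hw : ∀ i ∈ s, ‖w i‖ ≤ 1) :
    ‖∏ i ∈ s, z i - ∏ i ∈ s, w i‖ ≤ ∑ i ∈ s, ‖z i - w i‖ := by
  classical
  induction s using Finset.induction_on with
  | empty => simp
  | insert i s hi ih =>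
    rw [Finset.prod_insert hi, Finset.prod_insert hi, Finset.sum_insert hi]
    have ih' := ih (fun j hj => hz j (Finset.mem_insert_of_mem hj))
      (fun j hj => hw j (Finset.mem_insert_of_mem hj))
    have hW : ‖∏ j ∈ s, w j‖ ≤ 1 := by
      rw [norm_prod]
      exact Finset.prod_le_one (fun _ _ => norm_nonneg _)
        (fun j hj => hw j (Finset.mem_insert_of_mem hj))
    calc _ = ‖z i * (∏ j ∈ s, z j - ∏ j ∈ s, w j) + (z i - w i) * ∏ j ∈ s, w j‖ := by
          congr 1; ring
      _ ≤ ‖z i‖ * ‖∏ j ∈ s, z j - ∏ j ∈ s, w j‖ + ‖z i - w i‖ * ‖∏ j ∈ s, w j‖ := by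
          rw [← norm_mul, ← norm_mul]
          exact norm_add_le _ _
      _ ≤ 1 * ‖∏ j ∈ s, z j - ∏ j ∈ s, w j‖ + ‖z i - w i‖ * 1 := by
          gcongr
          exact hz i (Finset.mem_insert_self _ _)
      _ ≤ _ := by linarith

variable {Ω : Type*} [MeasurableSpace Ω] {P : Measure Ω} {X : Ω → ℂ}

/-- The variance of `Re (a X)`, for a centred complex random variable `X`. -/
noncomputable def varRe (P : Measure Ω) (X : Ω → ℂ) (a : ℂ) : ℝ := ∫ ω, (a * X ω).re ^ 2 ∂P

theorem varRe_nonneg (a : ℂ) : 0 ≤ varRe P X a := integral_nonneg fun _ => sq_nonneg _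

theorem integrable_re_mul_sq (hX : MemLp X 2 P) (a : ℂ) :
    Integrable (fun ω => (a * X ω).re ^ 2) P :=
  ((hX.const_mul a).re).integrable_sq

theorem integrable_norm_sq (hX : MemLp X 2 P) : Integrable (fun ω => ‖X ω‖ ^ 2) P :=
  hX.norm.integrable_sq

theorem varRe_le (hX : MemLp X 2 P) (a : ℂ) : varRe P X a ≤ ‖a‖ ^ 2 * ∫ ω, ‖X ω‖ ^ 2 ∂P := by
  rw [← integral_const_mul]
  refine integral_mono (integrable_re_mul_sq hX a) ((integrable_norm_sq hX).const_mul _) fun ω => ?_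
  rw [← mul_pow, ← norm_mul]
  exact sq_le_sq.2 ((Complex.abs_re_le_norm _).trans (le_abs_self _))

/-- As `Re (-i a X) = Im (a X)`, the two variances add up to the second moment of `a X`. -/
theorem varRe_add_varRe (hX : MemLp X 2 P) (a : ℂ) :
    varRe P X a + varRe P X (-Complex.I * a) = ‖a‖ ^ 2 * ∫ ω, ‖X ω‖ ^ 2 ∂P := by
  rw [varRe, varRe, ← integral_add (integrable_re_mul_sq hX _) (integrable_re_mul_sq hX _),
    ← integral_const_mul]
  congr 1 with ω
  rw [← mul_pow, ← norm_mul, Complex.sq_norm, Complex.normSq_apply, mul_assoc]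
  simp
  ring

/-- Second order expansion at `0` of the characteristic function of a centred complex random
variable, in a form in which the Gaussian characteristic function appears. -/
theorem exists_norm_integral_exp_sub_le [IsProbabilityMeasure P] (hX : MemLp X 2 P)
    (hmean : ∫ ω, X ω ∂P = 0) {ε : ℝ} (hε : 0 < ε) :
    ∃ δ > 0, ∀ a : ℂ, ‖a‖ ≤ δ →
      ‖∫ ω, Complex.exp (Complex.I * ((a * X ω).re : ℝ)) ∂P - Real.exp (-varRe P X a / 2)‖ ≤
        ε * ‖a‖ ^ 2 := by
  set S := ∫ ω, ‖X ω‖ ^ 2 ∂P with hS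
  have hS0 : 0 ≤ S := integral_nonneg fun _ => by positivity
  have hXi : Integrable X P := hX.integrable (by norm_num)
  have hsm : AEStronglyMeasurable X P := hX.aestronglyMeasurable
  -- the truncated second moments tend to `0`
  have hdct : Tendsto (fun d : ℝ => ∫ ω, ‖X ω‖ ^ 2 * min 1 (|d| * ‖X ω‖) ∂P) (𝓝 0) (𝓝 0) := by
    have := tendsto_integral_filter_of_dominated_convergence (μ := P) (l := 𝓝 (0 : ℝ))
      (F := fun (d : ℝ) ω => ‖X ω‖ ^ 2 * min 1 (|d| * ‖X ω‖)) (f := fun _ => (0 : ℝ))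
      (fun ω => ‖X ω‖ ^ 2) (Eventually.of_forall fun d =>
        (hsm.norm.pow 2).mul (aestronglyMeasurable_const.inf (hsm.norm.const_mul _)))
      (Eventually.of_forall fun d => Eventually.of_forall fun ω => ?_) (integrable_norm_sq hX)
      (Eventually.of_forall fun ω => ?_)
    · simpa using this
    · rw [Real.norm_of_nonneg (by positivity)]
      exact mul_le_of_le_one_right (by positivity) (min_le_left _ _)
    · have : Continuous fun d : ℝ => ‖X ω‖ ^ 2 * min 1 (|d| * ‖X ω‖) := by fun_prop
      simpa using this.tendsto 0
  obtain ⟨d, hd0, hd⟩ : ∃ d > 0, ∫ ω, ‖X ω‖ ^ 2 * min 1 (|d| * ‖X ω‖) ∂P ≤ ε / 8 := by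
    obtain ⟨r, hr, h⟩ := Metric.eventually_nhds_iff.1
      (hdct.eventually_le_const (show (0 : ℝ) < ε / 8 by positivity))
    refine ⟨r / 2, by positivity, h ?_⟩
    rw [dist_zero_right, Real.norm_of_nonneg (by positivity)]
    exact half_lt_self hr
  -- `e` is so small that `exp (-q / 2)` is close enough to `1 - q / 2` for `q ≤ e² S`
  obtain ⟨e, he0, he1, he2⟩ : ∃ e > 0, e ^ 2 * S ≤ 1 ∧ e ^ 2 * S ^ 2 ≤ ε := by
    have h1 : Tendsto (fun e : ℝ => e ^ 2 * S) (𝓝[>] 0) (𝓝 0) := by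
      have : Continuous fun e : ℝ => e ^ 2 * S := by fun_prop
      simpa using (this.tendsto 0).mono_left nhdsWithin_le_nhds
    have h2 : Tendsto (fun e : ℝ => e ^ 2 * S ^ 2) (𝓝[>] 0) (𝓝 0) := by
      have : Continuous fun e : ℝ => e ^ 2 * S ^ 2 := by fun_prop
      simpa using (this.tendsto 0).mono_left nhdsWithin_le_nhds
    obtain ⟨e, he⟩ := ((h1.eventually_le_const one_pos).and
      ((h2.eventually_le_const hε).and self_mem_nhdsWithin)).exists
    exact ⟨e, he.2.2, he.1, he.2.1⟩
  refine ⟨min d e, lt_min hd0 he0, fun a ha => ?_⟩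
  have had : ‖a‖ ≤ d := ha.trans (min_le_left _ _)
  have hae : ‖a‖ ≤ e := ha.trans (min_le_right _ _)
  set q := varRe P X a with hq
  have hq0 : 0 ≤ q := varRe_nonneg a
  have hqS : q ≤ ‖a‖ ^ 2 * S := varRe_le hX a
  have hare : Integrable (fun ω => (((a * X ω).re : ℝ) : ℂ)) P := ((hXi.const_mul a).re).ofReal
  have haresq : Integrable (fun ω => (((a * X ω).re : ℝ) : ℂ) ^ 2 / 2) P := by
    have := ((integrable_re_mul_sq hX a).ofReal (𝕜 := ℂ)).div_const 2
    simpa using this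
  have hexp : Integrable (fun ω => Complex.exp (Complex.I * ((a * X ω).re : ℝ))) P := by
    refine Integrable.of_bound (C := 1) ?_
      (Eventually.of_forall fun ω => (Complex.norm_exp_I_mul_ofReal _).le)
    exact Complex.continuous_exp.comp_aestronglyMeasurable
      (hare.aestronglyMeasurable.const_mul _)
  have hmean' : ∫ ω, (((a * X ω).re : ℝ) : ℂ) ∂P = 0 := by
    rw [integral_complex_ofReal]
    have := integral_re (hXi.const_mul a)
    rw [integral_const_mul, hmean, mul_zero] at this
    simpa using this
  have hsq' : ∫ ω, (((a * X ω).re : ℝ) : ℂ) ^ 2 / 2 ∂P = (q : ℂ) / 2 := by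
    rw [integral_div, hq, varRe, ← integral_complex_ofReal]
    simp
  have h1 : ‖∫ ω, Complex.exp (Complex.I * ((a * X ω).re : ℝ)) ∂P - (1 - q / 2)‖ ≤
      ε / 2 * ‖a‖ ^ 2 := by
    have e1 : ∫ ω, Complex.exp (Complex.I * ((a * X ω).re : ℝ)) ∂P - (1 - q / 2) =
        ∫ ω, (Complex.exp (Complex.I * ((a * X ω).re : ℝ)) - 1 - Complex.I * ((a * X ω).re : ℝ) +
          (((a * X ω).re : ℝ) : ℂ) ^ 2 / 2) ∂P := by
      have i1 : Integrable (fun ω => Complex.exp (Complex.I * ((a * X ω).re : ℝ)) - 1) P :=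
        hexp.sub (integrable_const _)
      have i2 : Integrable (fun ω => Complex.exp (Complex.I * ((a * X ω).re : ℝ)) - 1 -
          Complex.I * ((a * X ω).re : ℝ)) P := i1.sub (hare.const_mul _)
      rw [integral_add i2 haresq, integral_sub i1 (hare.const_mul _),
        integral_sub hexp (integrable_const _), integral_const_mul, hmean', hsq']
      simp
      ring
    rw [e1]
    calc _ ≤ ∫ ω, 4 * ‖a‖ ^ 2 * (‖X ω‖ ^ 2 * min 1 (|d| * ‖X ω‖)) ∂P := by
          refine norm_integral_le_of_norm_le ?_ (Eventually.of_forall fun ω => ?_)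
          · refine Integrable.const_mul ?_ _
            refine (integrable_norm_sq hX).mono'
              ((hsm.norm.pow 2).mul (aestronglyMeasurable_const.inf (hsm.norm.const_mul _)))
              (Eventually.of_forall fun ω => ?_)
            rw [Real.norm_of_nonneg (by positivity)]
            exact mul_le_of_le_one_right (by positivity) (min_le_left _ _)
          · have hre : |(a * X ω).re| ≤ ‖a‖ * ‖X ω‖ := by
              rw [← norm_mul]
              exact Complex.abs_re_le_norm _
            refine (norm_exp_I_mul_sub_le _).trans ?_
            have h2 : (a * X ω).re ^ 2 ≤ ‖a‖ ^ 2 * ‖X ω‖ ^ 2 := by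
              rw [← sq_abs, ← mul_pow]
              gcongr
            have h3 : min 1 |(a * X ω).re| ≤ min 1 (|d| * ‖X ω‖) := by
              refine min_le_min le_rfl (hre.trans ?_)
              gcongr
              exact had.trans (le_abs_self _)
            calc 4 * ((a * X ω).re ^ 2 * min 1 |(a * X ω).re|)
                ≤ 4 * ((‖a‖ ^ 2 * ‖X ω‖ ^ 2) * min 1 (|d| * ‖X ω‖)) := by gcongr
              _ = _ := by ring
      _ = 4 * ‖a‖ ^ 2 * ∫ ω, ‖X ω‖ ^ 2 * min 1 (|d| * ‖X ω‖) ∂P := integral_const_mul _ _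
      _ ≤ 4 * ‖a‖ ^ 2 * (ε / 8) := by gcongr
      _ = _ := by ring
  have h2 : ‖(1 - q / 2 : ℂ) - Real.exp (-q / 2)‖ ≤ ε / 2 * ‖a‖ ^ 2 := by
    have hae2 : ‖a‖ ^ 2 ≤ e ^ 2 := by gcongr
    have hq1 : q ≤ 1 := hqS.trans ((mul_le_mul_of_nonneg_right hae2 hS0).trans he1)
    have h3 := Real.norm_exp_sub_one_sub_id_le (x := -q / 2)
      (by rw [Real.norm_eq_abs, abs_le]; constructor <;> linarith)
    have e1 : (1 - q / 2 : ℂ) - Real.exp (-q / 2) =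
        ((-(Real.exp (-q / 2) - 1 - -q / 2) : ℝ) : ℂ) := by
      push_cast
      ring
    rw [e1, Complex.norm_real, norm_neg]
    refine h3.trans ?_
    rw [Real.norm_eq_abs, sq_abs]
    calc (-q / 2) ^ 2 = q ^ 2 / 4 := by ring
      _ ≤ (‖a‖ ^ 2 * S) ^ 2 / 4 := by gcongr
      _ = ‖a‖ ^ 2 * (‖a‖ ^ 2 * S ^ 2) / 4 := by ring
      _ ≤ ‖a‖ ^ 2 * (e ^ 2 * S ^ 2) / 4 := by gcongr
      _ ≤ ‖a‖ ^ 2 * ε / 4 := by gcongr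
      _ ≤ _ := by nlinarith [sq_nonneg ‖a‖]
  calc _ = ‖(∫ ω, Complex.exp (Complex.I * ((a * X ω).re : ℝ)) ∂P - (1 - q / 2)) +
        ((1 - q / 2 : ℂ) - Real.exp (-q / 2))‖ := by congr 1; ring
    _ ≤ ε / 2 * ‖a‖ ^ 2 + ε / 2 * ‖a‖ ^ 2 := (norm_add_le _ _).trans (add_le_add h1 h2)
    _ = _ := by ring

variable {ξ : ℕ → Ω → ℂ}

theorem integral_exp_re_sum [IsProbabilityMeasure P] (hm : ∀ k, Measurable (ξ k))
    (hindep : iIndepFun ξ P) (hident : ∀ k, IdentDistrib (ξ k) (ξ 0) P P) (a : ℕ → ℂ) (n : ℕ) :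
    ∫ ω, Complex.exp (Complex.I * ((∑ k ∈ Finset.range n, a k * ξ k ω).re : ℝ)) ∂P =
      ∏ k ∈ Finset.range n, ∫ ω, Complex.exp (Complex.I * ((a k * ξ 0 ω).re : ℝ)) ∂P := by
  have hc : ∀ c : ℂ, Measurable fun z : ℂ => Complex.exp (Complex.I * ((c * z).re : ℝ)) :=
    fun c => by fun_prop
  have hin : iIndepFun (fun (i : Fin n) => ξ i) P := hindep.precomp Fin.val_injective
  have h1 := iIndepFun.integral_fun_prod_comp (𝕜 := ℂ) (ι := Fin n) (X := fun i => ξ i)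
    (f := fun i z => Complex.exp (Complex.I * ((a i * z).re : ℝ)))
    hin (fun i => (hm i).aemeasurable) (fun i => (hc _).aestronglyMeasurable)
  rw [Finset.prod_range]
  calc _ = ∫ ω, ∏ i : Fin n, Complex.exp (Complex.I * ((a i * ξ i ω).re : ℝ)) ∂P := by
        congr 1 with ω
        rw [← Complex.exp_sum, Finset.sum_range, Complex.re_sum, Complex.ofReal_sum,
          Finset.mul_sum]
    _ = _ := h1
    _ = _ := by
        refine Finset.prod_congr rfl fun i _ => ?_
        exact ((hident i).comp (hc (a i))).integral_eq

theorem integral_re_sum_sq [IsProbabilityMeasure P] (hindep : iIndepFun ξ P)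
    (hident : ∀ k, IdentDistrib (ξ k) (ξ 0) P P)
    (hX : MemLp (ξ 0) 2 P) (hmean : ∫ ω, ξ 0 ω ∂P = 0) (a : ℕ → ℂ) (n : ℕ) :
    ∫ ω, (∑ k ∈ Finset.range n, a k * ξ k ω).re ^ 2 ∂P =
      ∑ k ∈ Finset.range n, varRe P (ξ 0) (a k) := by
  have hc : ∀ c : ℂ, Measurable fun z : ℂ => (c * z).re := fun c => by fun_prop
  have hL : ∀ k, MemLp (fun ω => (a k * ξ k ω).re) 2 P := fun k =>
    (((hident k).memLp_iff.2 hX).const_mul (a k)).re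
  have hzero : ∀ k, ∫ ω, (a k * ξ k ω).re ∂P = 0 := by
    intro k
    have h1 := ((hident k).comp (hc (a k))).integral_eq
    simp only [Function.comp_def] at h1
    rw [h1]
    have := integral_re ((hX.integrable (by norm_num)).const_mul (a k))
    rw [integral_const_mul, hmean, mul_zero] at this
    simpa using this
  have hvar := IndepFun.variance_sum (μ := P) (s := Finset.range n)
    (X := fun k ω => (a k * ξ k ω).re) (fun k _ => hL k)
    (fun i _ j _ hij => (hindep.indepFun hij).comp (hc (a i)) (hc (a j)))
  rw [variance_of_integral_eq_zero] at hvar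
  · have e1 : ∀ ω, (∑ k ∈ Finset.range n, fun ω => (a k * ξ k ω).re) ω =
        (∑ k ∈ Finset.range n, a k * ξ k ω).re := fun ω => by
      rw [Finset.sum_apply, Complex.re_sum]
    simp only [e1] at hvar
    rw [hvar]
    refine Finset.sum_congr rfl fun k _ => ?_
    rw [variance_of_integral_eq_zero (hL k).aemeasurable (hzero k), varRe]
    exact ((hident k).comp ((hc (a k)).pow_const 2)).integral_eq
  · exact (Finset.aemeasurable_sum _ fun k _ => (hL k).aemeasurable)
  · simp only [Finset.sum_apply]
    rw [integral_finsetSum _ fun k _ => (hL k).integrable (by norm_num)]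
    exact Finset.sum_eq_zero fun k _ => hzero k

theorem memLp_sum (hident : ∀ k, IdentDistrib (ξ k) (ξ 0) P P)
    (hX : MemLp (ξ 0) 2 P) (a : ℕ → ℂ) (n : ℕ) :
    MemLp (fun ω => ∑ k ∈ Finset.range n, a k * ξ k ω) 2 P :=
  memLp_finsetSum _ fun k _ => ((hident k).memLp_iff.2 hX).const_mul (a k)

theorem integral_norm_sum_sq [IsProbabilityMeasure P] (hindep : iIndepFun ξ P)
    (hident : ∀ k, IdentDistrib (ξ k) (ξ 0) P P)
    (hX : MemLp (ξ 0) 2 P) (hmean : ∫ ω, ξ 0 ω ∂P = 0) (a : ℕ → ℂ) (n : ℕ) :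
    ∫ ω, ‖∑ k ∈ Finset.range n, a k * ξ k ω‖ ^ 2 ∂P =
      (∑ k ∈ Finset.range n, ‖a k‖ ^ 2) * ∫ ω, ‖ξ 0 ω‖ ^ 2 ∂P := by
  have h1 := integral_re_sum_sq hindep hident hX hmean a n
  have h2 := integral_re_sum_sq hindep hident hX hmean (fun k => -Complex.I * a k) n
  rw [Finset.sum_mul, Finset.sum_congr rfl fun k _ => (varRe_add_varRe hX (a k)).symm,
    Finset.sum_add_distrib, ← h1, ← h2, ← integral_add]
  · congr 1 with ω
    rw [Complex.sq_norm, Complex.normSq_apply]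
    simp_rw [mul_assoc, ← Finset.mul_sum]
    simp
    ring
  · exact (memLp_sum hident hX a n).re.integrable_sq
  · exact (memLp_sum hident hX _ n).re.integrable_sq

/-- The central limit theorem for weighted sums of independent copies of a centred complex random
variable: the characteristic function converges to the Gaussian one when the weights are uniformly
negligible, have bounded square sums, and the variances converge. -/
theorem tendsto_integral_exp_re_sum [IsProbabilityMeasure P] (hm : ∀ k, Measurable (ξ k))
    (hindep : iIndepFun ξ P) (hident : ∀ k, IdentDistrib (ξ k) (ξ 0) P P)
    (hX : MemLp (ξ 0) 2 P) (hmean : ∫ ω, ξ 0 ω ∂P = 0) {a : ℕ → ℕ → ℂ} {M V : ℝ}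
    (hsmall : ∀ ε > 0, ∀ᶠ n in atTop, ∀ k ≤ n, ‖a n k‖ ≤ ε)
    (hbdd : ∀ᶠ n in atTop, ∑ k ∈ Finset.range (n + 1), ‖a n k‖ ^ 2 ≤ M)
    (hvar : Tendsto (fun n => ∑ k ∈ Finset.range (n + 1), varRe P (ξ 0) (a n k)) atTop (𝓝 V)) :
    Tendsto (fun n => ∫ ω, Complex.exp
        (Complex.I * ((∑ k ∈ Finset.range (n + 1), a n k * ξ k ω).re : ℝ)) ∂P) atTop
      (𝓝 (Real.exp (-V / 2) : ℂ)) := by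
  have hlim : Tendsto (fun n => ∏ k ∈ Finset.range (n + 1),
      (Real.exp (-varRe P (ξ 0) (a n k) / 2) : ℂ)) atTop (𝓝 (Real.exp (-V / 2) : ℂ)) := by
    have : Continuous fun v : ℝ => (Real.exp (-v / 2) : ℂ) := by fun_prop
    refine ((this.tendsto V).comp hvar).congr fun n => ?_
    simp only [Function.comp]
    rw [← Complex.ofReal_prod, ← Real.exp_sum]
    congr 2
    rw [← Finset.sum_neg_distrib, Finset.sum_div]
  have hdiff : Tendsto (fun n => ∫ ω, Complex.exp
        (Complex.I * ((∑ k ∈ Finset.range (n + 1), a n k * ξ k ω).re : ℝ)) ∂P -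
      ∏ k ∈ Finset.range (n + 1), (Real.exp (-varRe P (ξ 0) (a n k) / 2) : ℂ)) atTop (𝓝 0) := by
    rw [Metric.tendsto_atTop']
    intro ε hε
    obtain ⟨δ, hδ, h⟩ := exists_norm_integral_exp_sub_le hX hmean
      (ε := ε / (|M| + 1)) (by positivity)
    obtain ⟨N, hN⟩ := eventually_atTop.1 ((hsmall δ hδ).and hbdd)
    refine ⟨N, fun n hn => ?_⟩
    obtain ⟨h1, h2⟩ := hN n hn.le
    rw [dist_zero_right, integral_exp_re_sum hm hindep hident]
    calc _ ≤ ∑ k ∈ Finset.range (n + 1), ε / (|M| + 1) * ‖a n k‖ ^ 2 := by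
          refine (norm_prod_sub_prod_le _ _ _ (fun k _ => ?_) (fun k _ => ?_)).trans
            (Finset.sum_le_sum fun k hk => h _ (h1 k (Nat.lt_succ_iff.1 (Finset.mem_range.1 hk))))
          · refine (norm_integral_le_of_norm_le_const (C := 1)
              (Eventually.of_forall fun ω => (Complex.norm_exp_I_mul_ofReal _).le)).trans ?_
            simp
          · rw [Complex.norm_real, Real.norm_of_nonneg (Real.exp_pos _).le, Real.exp_le_one_iff]
            linarith [varRe_nonneg (P := P) (X := ξ 0) (a n k)]
      _ = ε / (|M| + 1) * ∑ k ∈ Finset.range (n + 1), ‖a n k‖ ^ 2 := by rw [Finset.mul_sum]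
      _ ≤ ε / (|M| + 1) * |M| := by
          gcongr
          exact h2.trans (le_abs_self M)
      _ < ε := by
          rw [div_mul_eq_mul_div, div_lt_iff₀ (by positivity)]
          nlinarith [abs_nonneg M]
  simpa using hdiff.add hlim

end LiquidPhase

/-! ### The space of entire functions: measurability, compactness, weak convergence -/

namespace LiquidPhase

namespace Entire

/-- The inclusion of the entire functions into the continuous functions. -/
def toContinuousMap (f : Entire) : C(ℂ, ℂ) := f.1

theorem isEmbedding_toContinuousMap : IsEmbedding toContinuousMap :=
  IsEmbedding.subtypeVal (p := fun f : C(ℂ, ℂ) => Differentiable ℂ f)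

instance : T2Space Entire := isEmbedding_toContinuousMap.t2Space

theorem continuous_eval (z : ℂ) : Continuous fun f : Entire => f z :=
  (continuous_eval_const (F := C(ℂ, ℂ)) z).comp isEmbedding_toContinuousMap.continuous

/-- The Borel `σ`-algebra on entire functions is generated by the evaluations: the condition
`f(K) ⊆ U` on a compact set `K` is a condition on a countable dense subset of `K`. -/
theorem measurable_iff {Ω : Type*} [MeasurableSpace Ω] {f : Ω → Entire} :
    Measurable f ↔ ∀ z, Measurable fun ω => f ω z := by
  refine ⟨fun hf z => (continuous_eval z).measurable.comp hf, fun hf => ?_⟩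
  have hborel : borel Entire = MeasurableSpace.comap toContinuousMap (borel C(ℂ, ℂ)) := by
    rw [← borel_comap, ← isEmbedding_toContinuousMap.eq_induced]
  have hgen := borel_eq_generateFrom_of_subbasis
    (ContinuousMap.compactOpen_eq (X := ℂ) (Y := ℂ))
  change Measurable[_, borel Entire] f
  rw [hborel, hgen, measurable_comap_iff]
  refine measurable_generateFrom ?_
  rintro _ ⟨K, hK, U, hU, rfl⟩
  have hK : IsCompact K := hK
  have hU : IsOpen U := hU
  obtain ⟨D, hD, hDd⟩ := TopologicalSpace.exists_countable_dense K
  -- `f ω '' K ⊆ U` exactly when `f ω` keeps a positive distance from `Uᶜ` on a dense subset of `K`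
  have hset : (toContinuousMap ∘ f) ⁻¹' {g | Set.MapsTo g K U} =
      ⋃ n : ℕ, ⋂ x ∈ D, {ω | ((n : ENNReal))⁻¹ ≤ Metric.infEDist (f ω x) Uᶜ} := by
    ext ω
    simp only [Set.mem_preimage, Function.comp, Set.mem_ofPred_eq, Set.mem_iUnion, Set.mem_iInter]
    have hcont : Continuous fun x : ℂ => Metric.infEDist (f ω x) Uᶜ :=
      Metric.continuous_infEDist.comp (f ω).1.continuous
    constructor
    · intro hmaps
      rcases K.eq_empty_or_nonempty with rfl | hne
      · exact ⟨0, fun x => x.2.elim⟩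
      · obtain ⟨x₀, hx₀, hmin⟩ := hK.exists_isMinOn hne hcont.continuousOn
        have hpos : Metric.infEDist (f ω x₀) Uᶜ ≠ 0 := by
          intro h0
          have := (Metric.mem_closure_iff_infEDist_zero).2 h0
          rw [hU.isClosed_compl.closure_eq] at this
          exact this (hmaps hx₀)
        obtain ⟨n, hn⟩ := ENNReal.exists_inv_nat_lt hpos
        exact ⟨n, fun x _ => hn.le.trans (hmin x.2)⟩
    · rintro ⟨n, hn⟩ x hx
      have hall : ∀ y : K, ((n : ENNReal))⁻¹ ≤ Metric.infEDist (f ω y) Uᶜ := by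
        have hcl : IsClosed {y : K | ((n : ENNReal))⁻¹ ≤ Metric.infEDist (f ω y) Uᶜ} :=
          isClosed_le continuous_const (hcont.comp continuous_subtype_val)
        have hsub : D ⊆ {y : K | ((n : ENNReal))⁻¹ ≤ Metric.infEDist (f ω y) Uᶜ} :=
          fun y hy => hn y hy
        intro y
        have := hcl.closure_subset_iff.2 hsub (hDd y)
        exact this
      by_contra hxU
      have h0 : Metric.infEDist (f ω x) Uᶜ = 0 := Metric.infEDist_zero_of_mem hxU
      have := hall ⟨x, hx⟩
      simp only [h0] at this
      simp at this
  rw [hset]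
  refine MeasurableSet.iUnion fun n => MeasurableSet.biInter hD fun x _ => ?_
  exact measurableSet_le measurable_const ((Metric.continuous_infEDist.measurable).comp (hf x))

theorem summable_two_pow_mul_pow_div_factorial (A R : ℝ) :
    Summable fun p : ℕ => A * 2 ^ p * R ^ p / p.factorial := by
  refine ((Real.summable_pow_div_factorial (2 * R)).mul_left A).congr fun p => ?_
  rw [mul_pow]
  ring

theorem norm_coeff_mul_pow_le {A R : ℝ} {c : ℕ → ℂ} (hc : ∀ p, ‖c p‖ ≤ A * 2 ^ p)
    {u : ℂ} (hu : ‖u‖ ≤ R) (p : ℕ) :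
    ‖c p * u ^ p / p.factorial‖ ≤ A * 2 ^ p * R ^ p / p.factorial := by
  rw [norm_div, norm_mul, norm_pow, RCLike.norm_natCast]
  have := (norm_nonneg _).trans (hc p)
  gcongr
  exact hc p

/-- The box of Taylor coefficients `c` with `‖c p‖ ≤ A 2 ^ p`. -/
def coeffBox (A : ℝ) : Set (ℕ → ℂ) := Set.univ.pi fun p => Metric.closedBall 0 (A * 2 ^ p)

theorem mem_coeffBox {A : ℝ} {c : ℕ → ℂ} : c ∈ coeffBox A ↔ ∀ p, ‖c p‖ ≤ A * 2 ^ p := by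
  simp [coeffBox]

theorem continuous_tsum_coeffBox (A : ℝ) :
    Continuous fun q : coeffBox A × ℂ => ∑' p : ℕ, q.1.1 p * q.2 ^ p / p.factorial := by
  rw [continuous_iff_continuousAt]
  intro q₀
  set R := ‖q₀.2‖ + 1
  have hopen : IsOpen {q : coeffBox A × ℂ | ‖q.2‖ < R} :=
    isOpen_lt (by fun_prop) continuous_const
  refine ContinuousOn.continuousAt (s := {q : coeffBox A × ℂ | ‖q.2‖ < R}) ?_
    (hopen.mem_nhds (by simp [R]))
  refine continuousOn_tsum (fun p => Continuous.continuousOn ?_)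
    (summable_two_pow_mul_pow_div_factorial A R)
    (fun p q hq => norm_coeff_mul_pow_le (mem_coeffBox.1 q.1.2) (le_of_lt hq) p)
  have h1 : Continuous fun q : coeffBox A × ℂ => q.1.1 p :=
    (continuous_apply p).comp (continuous_subtype_val.comp continuous_fst)
  fun_prop

theorem differentiable_tsum_coeffBox {A : ℝ} (c : coeffBox A) :
    Differentiable ℂ fun u : ℂ => ∑' p : ℕ, c.1 p * u ^ p / p.factorial := by
  intro u₀
  have h := Complex.differentiableOn_tsum_of_summable_norm
    (F := fun (p : ℕ) (u : ℂ) => c.1 p * u ^ p / p.factorial) (U := Metric.ball 0 (‖u₀‖ + 1))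
    (summable_two_pow_mul_pow_div_factorial A (‖u₀‖ + 1))
    (fun p => Differentiable.differentiableOn (by fun_prop)) Metric.isOpen_ball
    (fun p u hu => norm_coeff_mul_pow_le (mem_coeffBox.1 c.2) (mem_ball_zero_iff.1 hu).le p)
  exact (h u₀ (by simp)).differentiableAt (Metric.isOpen_ball.mem_nhds (by simp))

/-- The entire function with Taylor coefficients `c p / p!`. -/
noncomputable def ofCoeff {A : ℝ} (c : coeffBox A) : Entire :=
  ⟨⟨fun u => ∑' p : ℕ, c.1 p * u ^ p / p.factorial, (differentiable_tsum_coeffBox c).continuous⟩,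
    differentiable_tsum_coeffBox c⟩

theorem continuous_ofCoeff (A : ℝ) : Continuous (ofCoeff (A := A)) := by
  rw [isEmbedding_toContinuousMap.continuous_iff]
  exact ContinuousMap.continuous_of_continuous_uncurry _ (continuous_tsum_coeffBox A)

/-- By Tychonoff's theorem for the box of coefficients. -/
theorem isCompact_range_ofCoeff (A : ℝ) : IsCompact (Set.range (ofCoeff (A := A))) := by
  have : CompactSpace (coeffBox A) := isCompact_iff_compactSpace.1
    (isCompact_univ_pi fun p => isCompact_closedBall _ _)
  exact isCompact_range (continuous_ofCoeff A)

end Entire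

variable {m : ℕ}

/-- The real linear functional `G ↦ Re ∑ l, c l * G_{j l}(u l)` on tuples of entire functions, where
`p l = (j l, u l)`. -/
noncomputable def reSum {ι : Type} [Fintype ι] (p : ι → Fin m × ℂ) (c : ι → ℂ)
    (G : Fin m → Entire) : ℝ :=
  (∑ l, c l * G (p l).1 (p l).2).re

theorem continuous_eval_eval (q : Fin m × ℂ) : Continuous fun G : Fin m → Entire => G q.1 q.2 :=
  (Entire.continuous_eval q.2).comp (continuous_apply q.1)

theorem continuous_reSum {ι : Type} [Fintype ι] (p : ι → Fin m × ℂ) (c : ι → ℂ) :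
    Continuous (reSum p c) :=
  Complex.continuous_re.comp
    (continuous_finsetSum _ fun l _ => (continuous_eval_eval (p l)).const_mul (c l))

theorem measurable_eval_eval (q : Fin m × ℂ) :
    Measurable fun G : Fin m → Entire => G q.1 q.2 := (continuous_eval_eval q).measurable

/-- Every real linear functional on `ℂ^ι` has the form `x ↦ Re ∑ l, c l * x l`. -/
theorem exists_eq_re_sum {ι : Type*} [Fintype ι] (L : (ι → ℂ) →L[ℝ] ℝ) :
    ∃ c : ι → ℂ, ∀ x : ι → ℂ, L x = (∑ l, c l * x l).re := by
  classical
  refine ⟨fun q => ((L (Pi.single q 1) : ℝ) : ℂ) -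
    Complex.I * ((L (Pi.single q Complex.I) : ℝ) : ℂ), fun x => ?_⟩
  have h : x = ∑ q, ((x q).re • (Pi.single q 1 : ι → ℂ) +
      (x q).im • (Pi.single q Complex.I : ι → ℂ)) := by
    ext q
    rw [Finset.sum_apply, Finset.sum_eq_single q]
    · simp only [Pi.add_apply, Pi.smul_apply, Pi.single_eq_same, Complex.real_smul, mul_one]
      exact (Complex.re_add_im _).symm
    · intro r _ hr
      simp [Pi.single_eq_of_ne' hr]
    · simp
  conv_lhs => rw [h]
  rw [map_sum, Complex.re_sum]
  refine Finset.sum_congr rfl fun q _ => ?_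
  simp only [map_add, map_smul, smul_eq_mul]
  simp
  ring

/-- A probability measure on `𝒜(ℂ)^m` is determined by the characteristic functions of the real
linear functionals of finitely many evaluations. -/
theorem ext_of_integral_exp_reSum {μ ν : Measure (Fin m → Entire)} [IsProbabilityMeasure μ]
    [IsProbabilityMeasure ν]
    (h : ∀ (ι : Type) [Fintype ι] (p : ι → Fin m × ℂ) (c : ι → ℂ),
      ∫ G, Complex.exp (Complex.I * reSum p c G) ∂μ =
        ∫ G, Complex.exp (Complex.I * reSum p c G) ∂ν) : μ = ν := by
  let ev : (Fin m → Entire) → (Fin m × ℂ → ℂ) := fun G q => G q.1 q.2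
  have hev : Measurable ev := measurable_pi_iff.2 fun q => measurable_eval_eval q
  have hle : (inferInstance : MeasurableSpace (Fin m → Entire)) ≤
      MeasurableSpace.comap ev inferInstance := by
    have : @Measurable _ _ (MeasurableSpace.comap ev inferInstance) inferInstance
        (fun G : Fin m → Entire => G) := by
      refine @measurable_pi_lambda _ _ _ (MeasurableSpace.comap ev inferInstance) _ _ fun j => ?_
      refine (@Entire.measurable_iff _ (MeasurableSpace.comap ev inferInstance) _).2 fun z => ?_
      have h1 : @Measurable _ _ (MeasurableSpace.comap ev inferInstance) inferInstance ev :=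
        comap_measurable ev
      exact (measurable_pi_apply ((j, z) : Fin m × ℂ)).comp h1
    intro s hs
    exact this hs
  have hmap : ∀ I : Finset (Fin m × ℂ),
      (μ.map ev).map I.restrict = (ν.map ev).map I.restrict := by
    intro I
    have hr : Measurable (I.restrict (π := fun _ : Fin m × ℂ => ℂ)) := Finset.measurable_restrict I
    have := Measure.isProbabilityMeasure_map (μ := μ) hev.aemeasurable
    have := Measure.isProbabilityMeasure_map (μ := ν) hev.aemeasurable
    have := Measure.isProbabilityMeasure_map (μ := μ.map ev) hr.aemeasurable
    have := Measure.isProbabilityMeasure_map (μ := ν.map ev) hr.aemeasurable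
    refine Measure.ext_of_charFunDual (E := I → ℂ) (funext fun L => ?_)
    obtain ⟨c, hc⟩ := exists_eq_re_sum L
    have hLm : Measurable fun x : I → ℂ => Complex.exp ((L x : ℂ) * Complex.I) := by fun_prop
    have key : ∀ ρ : Measure (Fin m → Entire), charFunDual ((ρ.map ev).map I.restrict) L =
        ∫ G, Complex.exp (Complex.I * reSum (fun q : I => q.1) c G) ∂ρ := by
      intro ρ
      rw [charFunDual_apply, Measure.map_map hr hev,
        integral_map (hr.comp hev).aemeasurable hLm.aestronglyMeasurable]
      congr 1 with G
      rw [mul_comm, reSum, ← hc fun q : I => G q.1.1 q.1.2]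
      rfl
    rw [key, key, h]
  have hunique : μ.map ev = ν.map ev := by
    have := Measure.isProbabilityMeasure_map (μ := μ) hev.aemeasurable
    have := Measure.isProbabilityMeasure_map (μ := ν) hev.aemeasurable
    refine IsProjectiveLimit.unique (P := fun I => (ν.map ev).map I.restrict) (fun I => hmap I)
      (fun I => rfl)
  ext s hs
  obtain ⟨t, ht, rfl⟩ := hle s hs
  rw [← Measure.map_apply hev ht, ← Measure.map_apply hev ht, hunique]

theorem tendsto_integral_exp_reSum {κ : Type*} {l : Filter κ}
    {μ : κ → ProbabilityMeasure (Fin m → Entire)} {ν : ProbabilityMeasure (Fin m → Entire)}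
    (h : Tendsto μ l (𝓝 ν)) {ι : Type} [Fintype ι] (p : ι → Fin m × ℂ) (c : ι → ℂ) :
    Tendsto (fun n => ∫ G, Complex.exp (Complex.I * reSum p c G) ∂(μ n : Measure _)) l
      (𝓝 (∫ G, Complex.exp (Complex.I * reSum p c G) ∂(ν : Measure _))) := by
  rw [ProbabilityMeasure.tendsto_iff_forall_integral_rclike_tendsto ℂ] at h
  have hc := continuous_reSum p c
  exact h (BoundedContinuousFunction.ofNormedAddCommGroup
    (fun G => Complex.exp (Complex.I * reSum p c G)) (by fun_prop) 1
    (fun G => (Complex.norm_exp_I_mul_ofReal _).le))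

/-- A tight sequence for which the characteristic functions of all real linear functionals of
finitely many evaluations converge has a weak limit (by Prokhorov's theorem), and it converges to
every measure with the limiting characteristic functions. -/
theorem exists_and_tendsto_of_tight {μ : ℕ → ProbabilityMeasure (Fin m → Entire)} {N : ℕ}
    (htight : IsTightMeasureSet {x | ∃ ρ ∈ μ '' Set.Ici N, (ρ : Measure (Fin m → Entire)) = x})
    {φ : ∀ (ι : Type) [Fintype ι], (ι → Fin m × ℂ) → (ι → ℂ) → ℂ}
    (hφ : ∀ (ι : Type) [Fintype ι] (p : ι → Fin m × ℂ) (c : ι → ℂ),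
      Tendsto (fun n => ∫ G, Complex.exp (Complex.I * reSum p c G) ∂(μ n : Measure _)) atTop
        (𝓝 (φ ι p c))) :
    (∃ ν : ProbabilityMeasure (Fin m → Entire), ∀ (ι : Type) [Fintype ι] (p : ι → Fin m × ℂ)
      (c : ι → ℂ), ∫ G, Complex.exp (Complex.I * reSum p c G) ∂(ν : Measure _) = φ ι p c) ∧
    ∀ ν : ProbabilityMeasure (Fin m → Entire),
      (∀ (ι : Type) [Fintype ι] (p : ι → Fin m × ℂ) (c : ι → ℂ),
        ∫ G, Complex.exp (Complex.I * reSum p c G) ∂(ν : Measure _) = φ ι p c) →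
      Tendsto μ atTop (𝓝 ν) := by
  have hcompact := isCompact_closure_of_isTightMeasureSet htight
  have hlim : ∀ f : Ultrafilter ℕ, (f : Filter ℕ) ≤ atTop →
      ∃ ν : ProbabilityMeasure (Fin m → Entire), Tendsto μ f (𝓝 ν) ∧
        ∀ (ι : Type) [Fintype ι] (p : ι → Fin m × ℂ) (c : ι → ℂ),
          ∫ G, Complex.exp (Complex.I * reSum p c G) ∂(ν : Measure _) = φ ι p c := by
    intro f hf
    have hmem : ∀ᶠ n in (f : Filter ℕ), μ n ∈ closure (μ '' Set.Ici N) :=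
      hf ((eventually_ge_atTop N).mono fun n hn => subset_closure ⟨n, hn, rfl⟩)
    obtain ⟨ν, -, hν⟩ := hcompact.ultrafilter_le_nhds (f.map μ)
      (le_principal_iff.2 (Ultrafilter.mem_coe.2 hmem))
    exact ⟨ν, hν, fun ι _ p c =>
      tendsto_nhds_unique (tendsto_integral_exp_reSum hν p c) ((hφ ι p c).mono_left hf)⟩
  constructor
  · obtain ⟨ν, -, hν⟩ := hlim (Ultrafilter.of atTop) (Ultrafilter.of_le _)
    exact ⟨ν, hν⟩
  · intro ν hν
    rw [tendsto_iff_ultrafilter]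
    intro f hf
    obtain ⟨ν', hν', h'⟩ := hlim f hf
    have h1 : IsProbabilityMeasure (ν' : Measure (Fin m → Entire)) := ν'.2
    have h2 : IsProbabilityMeasure (ν : Measure (Fin m → Entire)) := ν.2
    have : ν' = ν := Subtype.ext
      (ext_of_integral_exp_reSum (μ := (ν' : Measure _)) (ν := (ν : Measure _))
        fun ι _ p c => (h' ι p c).trans (hν ι p c).symm)
    rwa [← this]

end LiquidPhase

/-! ### Complex Gaussian processes and their characteristic functions -/

namespace LiquidPhase

open ComplexConjugate in
/-- The variance of `Re ∑ l, c l * X (p l)` for a centred complex process `X` with covariance `Γ`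
and pseudo-covariance `Λ`. -/
noncomputable def gaussVar {T ι : Type*} [Fintype ι] (Γ Λ : T → T → ℂ) (p : ι → T) (c : ι → ℂ) :
    ℝ :=
  (∑ l, ∑ l', (c l * conj (c l') * Γ (p l) (p l') + c l * c l' * Λ (p l) (p l'))).re / 2

theorem gaussVar_const_mul {T ι : Type*} [Fintype ι] (Γ Λ : T → T → ℂ) (p : ι → T) (c : ι → ℂ)
    (t : ℝ) : gaussVar Γ Λ p (fun l => t * c l) = t ^ 2 * gaussVar Γ Λ p c := by
  rw [gaussVar, gaussVar, ← mul_div_assoc]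
  congr 1
  rw [← Complex.re_ofReal_mul]
  simp_rw [Finset.mul_sum, map_mul, Complex.conj_ofReal]
  congr 1
  refine Finset.sum_congr rfl fun l _ => Finset.sum_congr rfl fun l' _ => ?_
  push_cast
  ring

section

open ComplexConjugate

variable {T Ω : Type*} [MeasurableSpace Ω] {P : Measure Ω} {X : T → Ω → ℂ}
  {Γ Λ : T → T → ℂ}

theorem sq_re_sum_eq {ι : Type*} [Fintype ι] (c x : ι → ℂ) :
    (∑ l, c l * x l).re ^ 2 =
      (∑ l, ∑ l', (c l * conj (c l') * (x l * conj (x l')) +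
        c l * c l' * (x l * x l'))).re / 2 := by
  set z := ∑ l, c l * x l with hz
  have h1 : ∑ l, ∑ l', (c l * conj (c l') * (x l * conj (x l')) + c l * c l' * (x l * x l')) =
      z * conj z + z * z := by
    rw [hz, map_sum, Finset.sum_mul_sum, Finset.sum_mul_sum, ← Finset.sum_add_distrib]
    refine Finset.sum_congr rfl fun l _ => ?_
    rw [← Finset.sum_add_distrib]
    refine Finset.sum_congr rfl fun l' _ => ?_
    rw [map_mul]
    ring
  rw [h1]
  simp only [Complex.add_re, Complex.mul_re, Complex.conj_re, Complex.conj_im]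
  ring

theorem integral_sq_re_sum {ι : Type*} [Fintype ι] (hX : ∀ t, MemLp (X t) 2 P)
    (hΓ : ∀ q r, ∫ ω, X q ω * conj (X r ω) ∂P = Γ q r)
    (hΛ : ∀ q r, ∫ ω, X q ω * X r ω ∂P = Λ q r) (p : ι → T) (c : ι → ℂ) :
    ∫ ω, (∑ l, c l * X (p l) ω).re ^ 2 ∂P = gaussVar Γ Λ p c := by
  have i1 : ∀ q r, Integrable (fun ω => X q ω * conj (X r ω)) P := fun q r =>
    (hX q).integrable_mul ((hX r).star)
  have i2 : ∀ q r, Integrable (fun ω => X q ω * X r ω) P := fun q r =>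
    (hX q).integrable_mul (hX r)
  have i3 : ∀ l l', Integrable (fun ω => c l * conj (c l') * (X (p l) ω * conj (X (p l') ω)) +
      c l * c l' * (X (p l) ω * X (p l') ω)) P := fun l l' =>
    ((i1 _ _).const_mul _).add ((i2 _ _).const_mul _)
  have i4 : ∀ l, Integrable (fun ω => ∑ l', (c l * conj (c l') *
      (X (p l) ω * conj (X (p l') ω)) + c l * c l' * (X (p l) ω * X (p l') ω))) P := fun l =>
    integrable_finsetSum _ fun l' _ => i3 l l'
  simp_rw [sq_re_sum_eq]
  rw [integral_div, gaussVar]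
  congr 1
  have hre := integral_re (𝕜 := ℂ) (integrable_finsetSum (μ := P) Finset.univ fun l _ => i4 l)
  simp only [RCLike.re_to_complex] at hre
  rw [hre, integral_finsetSum _ fun l _ => i4 l]
  congr 1
  refine Finset.sum_congr rfl fun l _ => ?_
  rw [integral_finsetSum _ fun l' _ => i3 l l']
  refine Finset.sum_congr rfl fun l' _ => ?_
  rw [integral_add ((i1 _ _).const_mul _) ((i2 _ _).const_mul _), integral_const_mul,
    integral_const_mul, hΓ, hΛ]

/-- The characteristic functions of the real linear functionals of a centred complex Gaussian
process are determined by its covariance and pseudo-covariance. -/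
theorem integral_exp_re_sum_of_isGaussianProcess {ι : Type*} [Fintype ι]
    (hG : IsGaussianProcess X P) (hmean : ∀ t, ∫ ω, X t ω ∂P = 0)
    (hΓ : ∀ q r, ∫ ω, X q ω * conj (X r ω) ∂P = Γ q r)
    (hΛ : ∀ q r, ∫ ω, X q ω * X r ω ∂P = Λ q r) (p : ι → T) (c : ι → ℂ) :
    ∫ ω, Complex.exp (Complex.I * ((∑ l, c l * X (p l) ω).re : ℝ)) ∂P =
      Real.exp (-gaussVar Γ Λ p c / 2) := by
  have hX : ∀ t, MemLp (X t) 2 P := fun t => (hG.hasGaussianLaw_eval t).memLp_two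
  set Y : Ω → ℝ := fun ω => (∑ l, c l * X (p l) ω).re with hY
  have hYG : HasGaussianLaw Y P := by
    have h1 := ((hG.comp_right p).comp_left
      (fun l => Complex.reCLM ∘L ((ContinuousLinearMap.mul ℝ ℂ) (c l)))).hasGaussianLaw_fun_sum
      (I := Finset.univ)
    refine h1.congr (Eventually.of_forall fun ω => ?_)
    simp [hY, Complex.re_sum]
  have hint : ∀ t, Integrable (X t) P := fun t => (hG.hasGaussianLaw_eval t).integrable
  have hYmean : ∫ ω, Y ω ∂P = 0 := by
    have i1 : Integrable (fun ω => ∑ l, c l * X (p l) ω) P :=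
      integrable_finsetSum _ fun l _ => (hint _).const_mul _
    have hre := integral_re (𝕜 := ℂ) i1
    simp only [RCLike.re_to_complex] at hre
    rw [hY, hre, integral_finsetSum _ fun l _ => (hint _).const_mul _]
    simp [integral_const_mul, hmean]
  have hvar : Var[Y; P] = gaussVar Γ Λ p c := by
    rw [variance_of_integral_eq_zero hYG.aemeasurable hYmean]
    exact integral_sq_re_sum hX hΓ hΛ p c
  have hchar : charFun (P.map Y) 1 =
      charFun (gaussianReal (∫ ω, Y ω ∂P) Var[Y; P].toNNReal) 1 := by
    rw [hYG.map_eq_gaussianReal]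
  rw [charFun_gaussianReal, charFun_apply_real,
    integral_map hYG.aemeasurable (by fun_prop), hYmean] at hchar
  have hnn : 0 ≤ gaussVar Γ Λ p c := hvar ▸ variance_nonneg Y P
  rw [hvar, Real.coe_toNNReal _ hnn] at hchar
  rw [Complex.ofReal_exp]
  convert hchar using 1
  · congr 1 with ω
    rw [mul_comm, Complex.ofReal_one, one_mul]
  · congr 1
    push_cast
    ring

/-- The law of `Re ∑ l, c l * X (p l)` is read off its characteristic function. -/
theorem hasLaw_re_sum_of_integral_exp [IsProbabilityMeasure P] (hm : ∀ t, Measurable (X t))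
    {ι : Type*} [Fintype ι] (p : ι → T)
    (h : ∀ c : ι → ℂ, ∫ ω, Complex.exp (Complex.I * ((∑ l, c l * X (p l) ω).re : ℝ)) ∂P =
      Real.exp (-gaussVar Γ Λ p c / 2)) (c : ι → ℂ) :
    0 ≤ gaussVar Γ Λ p c ∧
      HasLaw (fun ω => (∑ l, c l * X (p l) ω).re) (gaussianReal 0 (gaussVar Γ Λ p c).toNNReal)
        P := by
  have hnn : 0 ≤ gaussVar Γ Λ p c := by
    have h1 : ‖∫ ω, Complex.exp (Complex.I * ((∑ l, c l * X (p l) ω).re : ℝ)) ∂P‖ ≤ 1 := by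
      refine (norm_integral_le_of_norm_le_const (C := 1)
        (Eventually.of_forall fun ω => (Complex.norm_exp_I_mul_ofReal _).le)).trans ?_
      simp
    rw [h, Complex.norm_real, Real.norm_of_nonneg (Real.exp_pos _).le, Real.exp_le_one_iff] at h1
    linarith
  have hYm : Measurable fun ω => (∑ l, c l * X (p l) ω).re :=
    Complex.measurable_re.comp (Finset.measurable_fun_sum _ fun l _ => (hm _).const_mul _)
  refine ⟨hnn, ⟨hYm.aemeasurable, ?_⟩⟩
  have := Measure.isProbabilityMeasure_map (μ := P) hYm.aemeasurable
  refine Measure.ext_of_charFun (funext fun t => ?_)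
  rw [charFun_gaussianReal, charFun_apply_real, integral_map hYm.aemeasurable (by fun_prop),
    Real.coe_toNNReal _ hnn]
  have h1 := h fun l => t * c l
  rw [gaussVar_const_mul, Complex.ofReal_exp] at h1
  convert h1 using 1
  · congr 1 with ω
    simp_rw [mul_assoc, ← Finset.mul_sum]
    rw [Complex.re_ofReal_mul]
    push_cast
    ring_nf
  · congr 1
    push_cast
    ring

/-- A complex process whose real linear functionals have the characteristic functions
`exp (-gaussVar Γ Λ p c / 2)` is centred Gaussian with covariance `Γ` and pseudo-covariance `Λ`; the
moments follow by polarization. -/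
theorem isGaussianProcess_of_integral_exp [IsProbabilityMeasure P] {T : Type} {X : T → Ω → ℂ}
    {Γ Λ : T → T → ℂ} (hm : ∀ t, Measurable (X t))
    (hΓ : ∀ q r, Γ r q = conj (Γ q r)) (hΛ : ∀ q r, Λ r q = Λ q r)
    (h : ∀ (ι : Type) [Fintype ι] (p : ι → T) (c : ι → ℂ),
      ∫ ω, Complex.exp (Complex.I * ((∑ l, c l * X (p l) ω).re : ℝ)) ∂P =
        Real.exp (-gaussVar Γ Λ p c / 2)) :
    IsGaussianProcess X P ∧ (∀ t, ∫ ω, X t ω ∂P = 0) ∧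
      (∀ q r, ∫ ω, X q ω * conj (X r ω) ∂P = Γ q r) ∧
      (∀ q r, ∫ ω, X q ω * X r ω ∂P = Λ q r) := by
  have hlaw : ∀ {ι : Type} [Fintype ι] (p : ι → T) (c : ι → ℂ), 0 ≤ gaussVar Γ Λ p c ∧
      HasLaw (fun ω => (∑ l, c l * X (p l) ω).re) (gaussianReal 0 (gaussVar Γ Λ p c).toNNReal) P :=
    fun p c => hasLaw_re_sum_of_integral_exp hm p (h _ p) c
  have hG : IsGaussianProcess X P := by
    refine ⟨fun I => ⟨isGaussian_of_map_eq_gaussianReal fun L => ?_⟩⟩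
    obtain ⟨c, hc⟩ := exists_eq_re_sum L
    have hr : Measurable fun ω => I.restrict (X · ω) := measurable_pi_iff.2 fun i => hm i
    refine ⟨0, (gaussVar Γ Λ (fun i : I => i.1) c).toNNReal, ?_⟩
    rw [← (hlaw (fun i : I => i.1) c).2.map_eq, Measure.map_map (by fun_prop) hr]
    congr 1
    ext ω
    exact hc _
  have hX : ∀ t, MemLp (X t) 2 P := fun t => (hG.hasGaussianLaw_eval t).memLp_two
  have hint : ∀ t, Integrable (X t) P := fun t => (hG.hasGaussianLaw_eval t).integrable
  -- `a = 1` and `a = -i` give the real and imaginary parts of `X q`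
  have hU : ∀ (q : T) (a : ℂ), HasLaw (fun ω => (a * X q ω).re)
      (gaussianReal 0 (gaussVar Γ Λ (fun _ : Unit => q) (fun _ => a)).toNNReal) P := by
    intro q a
    simpa using (hlaw (fun _ : Unit => q) (fun _ => a)).2
  have hmeanU : ∀ (q : T) (a : ℂ), ∫ ω, (a * X q ω).re ∂P = 0 := fun q a => by
    rw [(hU q a).integral_eq, integral_id_gaussianReal]
  have hmean : ∀ t, ∫ ω, X t ω ∂P = 0 := by
    intro t
    have hre := integral_re (𝕜 := ℂ) (hint t)
    have him := integral_im (𝕜 := ℂ) (hint t)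
    simp only [RCLike.re_to_complex, RCLike.im_to_complex] at hre him
    apply Complex.ext
    · rw [← hre]
      simpa using hmeanU t 1
    · rw [← him]
      simpa using hmeanU t (-Complex.I)
  have hsq : ∀ {ι : Type} [Fintype ι] (p : ι → T) (c : ι → ℂ),
      ∫ ω, (∑ l, c l * X (p l) ω).re ^ 2 ∂P = gaussVar Γ Λ p c := by
    intro ι _ p c
    have h1 := (hlaw p c).2
    rw [← variance_of_integral_eq_zero h1.aemeasurable
      (by rw [h1.integral_eq, integral_id_gaussianReal]), h1.variance_eq,
      variance_id_gaussianReal, Real.coe_toNNReal _ (hlaw p c).1]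
  have hL2 : ∀ q (a : ℂ), MemLp (fun ω => (a * X q ω).re) 2 P := fun q a =>
    ((hX q).const_mul a).re
  -- polarization: the mixed moment is read off the variances of `Re (a X q + d X r)`, `Re (a X q)`
  -- and `Re (d X r)`
  have hpol : ∀ (q r : T) (a d : ℂ), ∫ ω, (a * X q ω).re * (d * X r ω).re ∂P =
      (a * conj d * Γ q r + a * d * Λ q r).re / 2 := by
    intro q r a d
    have h2 := hsq ![q, r] ![a, d]
    have h3 := hsq ![q] ![a]
    have h4 := hsq ![r] ![d]
    simp only [gaussVar, Fin.sum_univ_two, Fin.sum_univ_one, Matrix.cons_val_zero,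
      Matrix.cons_val_one, Matrix.cons_val_fin_one, Complex.add_re (_ * _)] at h2 h3 h4
    have e1 : ∫ ω, ((a * X q ω).re + (d * X r ω).re) ^ 2 ∂P =
        ∫ ω, (a * X q ω).re ^ 2 ∂P + 2 * ∫ ω, (a * X q ω).re * (d * X r ω).re ∂P +
          ∫ ω, (d * X r ω).re ^ 2 ∂P := by
      have i1 := (hL2 q a).integrable_sq
      have i2 := (hL2 r d).integrable_sq
      have i3 : Integrable (fun ω => 2 * ((a * X q ω).re * (d * X r ω).re)) P :=
        ((hL2 q a).integrable_mul (hL2 r d)).const_mul 2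
      have i4 : Integrable (fun ω => (a * X q ω).re ^ 2 +
          2 * ((a * X q ω).re * (d * X r ω).re)) P := i1.add i3
      rw [← integral_const_mul, ← integral_add i1 i3, ← integral_add i4 i2]
      congr 1 with ω
      ring
    rw [h2, h3, h4] at e1
    have e2 : (d * conj a * Γ r q).re = (a * conj d * Γ q r).re := by
      rw [hΓ q r, ← Complex.conj_re]
      congr 1
      simp only [map_mul, Complex.conj_conj]
      ring
    have e3 : d * a * Λ r q = a * d * Λ q r := by rw [hΛ]; ring
    simp only [Complex.add_re, e2, e3] at e1 ⊢
    linarith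
  have hi : ∀ q r (a d : ℂ), Integrable (fun ω => (a * X q ω).re * (d * X r ω).re) P :=
    fun q r a d => (hL2 q a).integrable_mul (hL2 r d)
  -- the integrand is `X q * conj (X r)` for `σ = 1` and `X q * X r` for `σ = -1`
  have hcomb : ∀ (q r : T) (σ : ℝ), ∫ ω, ((((1 * X q ω).re * (1 * X r ω).re +
      σ * ((-Complex.I * X q ω).re * (-Complex.I * X r ω).re) : ℝ) : ℂ) +
      (((-Complex.I * X q ω).re * (1 * X r ω).re - σ *
        ((1 * X q ω).re * (-Complex.I * X r ω).re) : ℝ) : ℂ) * Complex.I) ∂P =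
      ((((Γ q r + Λ q r).re + σ * (Γ q r - Λ q r).re) / 2 : ℝ) : ℂ) +
      ((((Γ q r + Λ q r).im - σ * (Λ q r - Γ q r).im) / 2 : ℝ) : ℂ) * Complex.I := by
    intro q r σ
    have i1 : Integrable (fun ω => (((1 * X q ω).re * (1 * X r ω).re +
        σ * ((-Complex.I * X q ω).re * (-Complex.I * X r ω).re) : ℝ) : ℂ)) P :=
      ((hi q r 1 1).add ((hi q r (-Complex.I) (-Complex.I)).const_mul σ)).ofReal
    have i2 : Integrable (fun ω => (((-Complex.I * X q ω).re * (1 * X r ω).re -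
        σ * ((1 * X q ω).re * (-Complex.I * X r ω).re) : ℝ) : ℂ)) P :=
      ((hi q r (-Complex.I) 1).sub ((hi q r 1 (-Complex.I)).const_mul σ)).ofReal
    rw [integral_add i1 (i2.mul_const _), integral_mul_const, integral_complex_ofReal,
      integral_complex_ofReal, integral_add (hi q r 1 1) ((hi q r _ _).const_mul σ),
      integral_sub (hi q r _ 1) ((hi q r 1 _).const_mul σ), integral_const_mul,
      integral_const_mul, hpol, hpol, hpol, hpol]
    congr 3
    · simp
      ring
    · simp
      ring
  refine ⟨hG, hmean, fun q r => ?_, fun q r => ?_⟩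
  · have h1 := hcomb q r 1
    have e : ∀ z : ℂ, z = ((((Γ q r + Λ q r).re + 1 * (Γ q r - Λ q r).re) / 2 : ℝ) : ℂ) +
      ((((Γ q r + Λ q r).im - 1 * (Λ q r - Γ q r).im) / 2 : ℝ) : ℂ) * Complex.I → z = Γ q r := by
      rintro z rfl
      apply Complex.ext <;> simp <;> ring
    rw [← e _ h1]
    congr 1 with ω
    apply Complex.ext <;> simp <;> ring
  · have h1 := hcomb q r (-1)
    have e : ∀ z : ℂ, z = ((((Γ q r + Λ q r).re + (-1) * (Γ q r - Λ q r).re) / 2 : ℝ) : ℂ) +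
      ((((Γ q r + Λ q r).im - (-1) * (Λ q r - Γ q r).im) / 2 : ℝ) : ℂ) * Complex.I →
        z = Λ q r := by
      rintro z rfl
      apply Complex.ext <;> simp <;> ring
    rw [← e _ h1]
    congr 1 with ω
    apply Complex.ext <;> simp <;> ring

end

end LiquidPhase

/-! ### The covariance structure of the limit -/

namespace LiquidPhase

section

open ComplexConjugate

theorem exp_I_mul_add_eq_one_iff {x y : ℝ} (hx : x ∈ Set.Ico 0 (2 * Real.pi))
    (hy : y ∈ Set.Ico 0 (2 * Real.pi)) :
    Complex.exp (Complex.I * x) * Complex.exp (Complex.I * y) = 1 ↔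
      x + y = 0 ∨ x + y = 2 * Real.pi := by
  rw [← Complex.exp_add, Complex.exp_eq_one_iff]
  have hπ := Real.pi_pos
  constructor
  · rintro ⟨k, hk⟩
    have h1 : x + y = k * (2 * Real.pi) := by
      have := congrArg Complex.im hk
      simpa using this
    have h2 : (-1 : ℝ) < k := by
      by_contra! h
      nlinarith [hx.1, hy.1]
    have h3 : (k : ℝ) < 2 := by
      by_contra! h
      nlinarith [hx.2, hy.2]
    have h4 : k = 0 ∨ k = 1 := by
      have : -1 < k := by exact_mod_cast h2
      have : k < 2 := by exact_mod_cast h3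
      omega
    rcases h4 with rfl | rfl
    · left; simpa using h1
    · right; simpa using h1
  · rintro (h | h)
    · refine ⟨0, ?_⟩
      rw [← mul_add, ← Complex.ofReal_add, h]
      simp
    · refine ⟨1, ?_⟩
      rw [← mul_add, ← Complex.ofReal_add, h]
      push_cast
      ring

theorem exp_I_mul_mul_conj_eq_one_iff {x y : ℝ} (hx : x ∈ Set.Ico 0 (2 * Real.pi))
    (hy : y ∈ Set.Ico 0 (2 * Real.pi)) :
    Complex.exp (Complex.I * x) * conj (Complex.exp (Complex.I * y)) = 1 ↔ x = y := by
  rw [← Complex.exp_conj, ← Complex.exp_add, Complex.exp_eq_one_iff]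
  have hπ := Real.pi_pos
  constructor
  · rintro ⟨k, hk⟩
    have h1 : x - y = k * (2 * Real.pi) := by
      have := congrArg Complex.im hk
      simpa [sub_eq_add_neg] using this
    have h2 : (-1 : ℝ) < k := by
      by_contra! h
      nlinarith [hx.1, hy.2]
    have h3 : (k : ℝ) < 1 := by
      by_contra! h
      nlinarith [hx.2, hy.1]
    have h4 : k = 0 := by
      have : -1 < k := by exact_mod_cast h2
      have : k < 1 := by exact_mod_cast h3
      omega
    subst h4
    simp at h1
    linarith
  · rintro rfl
    exact ⟨0, by simp⟩

variable {m : ℕ}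

/-- The covariance of the limit, as a function of pairs `(j, u)`.  The case distinction is that of
the weighted Riemann sums, at the point `e^{iψ_j} conj(e^{iψ_k})` of the unit circle. -/
noncomputable def limitCov (α s₁ s₂ : ℝ) (ψ : Fin m → ℝ) (q r : Fin m × ℂ) : ℂ :=
  ((s₁ + s₂ : ℝ) : ℂ) *
    if Complex.exp (Complex.I * ψ q.1) * conj (Complex.exp (Complex.I * ψ r.1)) = 1 then
      kernel α (q.2 + conj r.2) else 0

/-- The pseudo-covariance of the limit, as a function of pairs `(j, u)`. -/
noncomputable def limitPcov (α s₁ s₂ : ℝ) (ψ : Fin m → ℝ) (q r : Fin m × ℂ) : ℂ :=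
  ((s₁ - s₂ : ℝ) : ℂ) *
    if Complex.exp (Complex.I * ψ q.1) * Complex.exp (Complex.I * ψ r.1) = 1 then
      kernel α (q.2 + r.2) else 0

theorem kernel_conj (α : ℝ) (w : ℂ) : kernel α (conj w) = conj (kernel α w) := by
  rw [kernel, kernel, intervalIntegral.integral_of_le zero_le_one,
    intervalIntegral.integral_of_le zero_le_one, ← integral_conj]
  congr 1 with x
  rw [map_mul, Complex.conj_ofReal, ← Complex.exp_conj, map_mul, Complex.conj_ofReal]

variable {α s₁ s₂ : ℝ} {ψ : Fin m → ℝ}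

theorem limitCov_symm (q r : Fin m × ℂ) :
    limitCov α s₁ s₂ ψ r q = conj (limitCov α s₁ s₂ ψ q r) := by
  have h1 : ∀ x y : ℂ, y * conj x = 1 ↔ x * conj y = 1 := fun x y => by
    rw [← (starRingEnd ℂ).injective.eq_iff (a := x * conj y)]
    simp [mul_comm]
  simp only [limitCov, map_mul, Complex.conj_ofReal, apply_ite conj, ← kernel_conj, map_zero,
    map_add, Complex.conj_conj, add_comm (conj q.2), h1 (Complex.exp (Complex.I * ψ q.1))]

theorem limitPcov_symm (q r : Fin m × ℂ) :
    limitPcov α s₁ s₂ ψ r q = limitPcov α s₁ s₂ ψ q r := by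
  simp only [limitPcov, add_comm r.2, mul_comm (Complex.exp (Complex.I * ψ r.1))]

theorem limitCov_eq (hψ : ∀ j, ψ j ∈ Set.Ico 0 (2 * Real.pi)) (hinj : Function.Injective ψ)
    (i j : Fin m) (u v : ℂ) : limitCov α s₁ s₂ ψ (i, u) (j, v) =
      if i = j then ((s₁ + s₂ : ℝ) : ℂ) * kernel α (u + conj v) else 0 := by
  simp only [limitCov, exp_I_mul_mul_conj_eq_one_iff (hψ i) (hψ j), hinj.eq_iff, mul_ite, mul_zero]

theorem limitPcov_self (hψ : ∀ j, ψ j ∈ Set.Ico 0 (2 * Real.pi)) (j : Fin m) (u v : ℂ) :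
    limitPcov α s₁ s₂ ψ (j, u) (j, v) =
      if ψ j = 0 ∨ ψ j = Real.pi then ((s₁ - s₂ : ℝ) : ℂ) * kernel α (u + v) else 0 := by
  have h : ψ j + ψ j = 0 ∨ ψ j + ψ j = 2 * Real.pi ↔ ψ j = 0 ∨ ψ j = Real.pi := by
    constructor <;> rintro (h | h) <;> [left; right; left; right] <;> linarith
  simp only [limitPcov, exp_I_mul_add_eq_one_iff (hψ j) (hψ j), h, mul_ite, mul_zero]

theorem limitPcov_ne (hψ : ∀ j, ψ j ∈ Set.Ico 0 (2 * Real.pi)) (hinj : Function.Injective ψ)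
    {i j : Fin m} (hij : i ≠ j) (u v : ℂ) : limitPcov α s₁ s₂ ψ (i, u) (j, v) =
      if ψ i + ψ j = 2 * Real.pi then ((s₁ - s₂ : ℝ) : ℂ) * kernel α (u + v) else 0 := by
  have h : ψ i + ψ j = 0 ∨ ψ i + ψ j = 2 * Real.pi ↔ ψ i + ψ j = 2 * Real.pi := by
    refine or_iff_right fun h => hij (hinj ?_)
    linarith [(hψ i).1, (hψ j).1]
  simp only [limitPcov, exp_I_mul_add_eq_one_iff (hψ i) (hψ j), h, mul_ite, mul_zero]

/-- The prescribed covariance structure determines the characteristic functions of the limit. -/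
theorem IsGaussianLimit.integral_exp_reSum {Ω' : Type*} [MeasurableSpace Ω'] {μ : Measure Ω'}
    {G : Ω' → Fin m → Entire} (hG : IsGaussianLimit α s₁ s₂ ψ G μ)
    (hψ : ∀ j, ψ j ∈ Set.Ico 0 (2 * Real.pi)) (hinj : Function.Injective ψ)
    {ι : Type} [Fintype ι] (p : ι → Fin m × ℂ) (c : ι → ℂ) :
    ∫ ω, Complex.exp (Complex.I * reSum p c (G ω)) ∂μ =
      Real.exp (-gaussVar (limitCov α s₁ s₂ ψ) (limitPcov α s₁ s₂ ψ) p c / 2) := by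
  refine integral_exp_re_sum_of_isGaussianProcess (X := fun (p : Fin m × ℂ) ω => G ω p.1 p.2)
    hG.gaussian (fun q => hG.centered q.1 q.2) ?_ ?_ p c
  · rintro ⟨i, u⟩ ⟨j, v⟩
    rw [limitCov_eq hψ hinj]
    split_ifs with hij
    · subst hij
      exact hG.cov_self i u v
    · exact hG.cov_cross i j hij u v
  · rintro ⟨i, u⟩ ⟨j, v⟩
    rcases eq_or_ne i j with rfl | hij
    · rw [limitPcov_self hψ]
      split_ifs with h
      · exact hG.pcov_self_real i u v h
      · rw [not_or] at h
        exact hG.pcov_self_nonreal i u v h.1 h.2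
    · rw [limitPcov_ne hψ hinj hij]
      split_ifs with h
      · exact hG.pcov_cross_conj i j hij h u v
      · exact hG.pcov_cross_nonconj i j hij h u v

/-- The converse of `IsGaussianLimit.integral_exp_reSum`. -/
theorem isGaussianLimit_of_integral_exp_reSum {ν : Measure (Fin m → Entire)}
    [IsProbabilityMeasure ν] (hψ : ∀ j, ψ j ∈ Set.Ico 0 (2 * Real.pi))
    (hinj : Function.Injective ψ)
    (h : ∀ (ι : Type) [Fintype ι] (p : ι → Fin m × ℂ) (c : ι → ℂ),
      ∫ G, Complex.exp (Complex.I * reSum p c G) ∂ν =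
        Real.exp (-gaussVar (limitCov α s₁ s₂ ψ) (limitPcov α s₁ s₂ ψ) p c / 2)) :
    IsGaussianLimit α s₁ s₂ ψ (fun G => G) ν := by
  obtain ⟨h1, h2, h3, h4⟩ := isGaussianProcess_of_integral_exp (P := ν)
    (X := fun (p : Fin m × ℂ) G => G p.1 p.2) measurable_eval_eval
    limitCov_symm limitPcov_symm h
  constructor
  · exact measurable_id
  · exact h1
  · exact fun j u => h2 (j, u)
  · intro j u v
    rw [h3 (j, u) (j, v), limitCov_eq hψ hinj, if_pos rfl]
  · intro j u v hj
    rw [h4 (j, u) (j, v), limitPcov_self hψ, if_pos hj]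
  · intro j u v hj hj'
    rw [h4 (j, u) (j, v), limitPcov_self hψ, if_neg (not_or.2 ⟨hj, hj'⟩)]
  · intro i j hij u v
    rw [h3 (i, u) (j, v), limitCov_eq hψ hinj, if_neg hij]
  · intro i j hij hs u v
    rw [h4 (i, u) (j, v), limitPcov_ne hψ hinj hij, if_pos hs]
  · intro i j hij hs u v
    rw [h4 (i, u) (j, v), limitPcov_ne hψ hinj hij, if_neg hs]

/-! ### Finite-dimensional convergence of the rescaled polynomials -/

variable {Ω : Type*} [MeasurableSpace Ω] {P : Measure Ω} {ξ : ℕ → Ω → ℂ} {b : ℝ → ℝ}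

/-- The variance of `Re (a X)` when the real and imaginary parts of `X` are uncorrelated. -/
theorem varRe_eq {X : Ω → ℂ} (hre : MemLp (fun ω => (X ω).re) 2 P)
    (him : MemLp (fun ω => (X ω).im) 2 P) (hcross : ∫ ω, (X ω).re * (X ω).im ∂P = 0)
    (hs₁ : s₁ = ∫ ω, (X ω).re ^ 2 ∂P) (hs₂ : s₂ = ∫ ω, (X ω).im ^ 2 ∂P) (a : ℂ) :
    varRe P X a =
      (((s₁ + s₂ : ℝ) : ℂ) * (a * conj a) + ((s₁ - s₂ : ℝ) : ℂ) * (a * a)).re / 2 := by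
  have i1 : Integrable (fun ω => a.re ^ 2 * (X ω).re ^ 2) P := hre.integrable_sq.const_mul _
  have i2 : Integrable (fun ω => a.im ^ 2 * (X ω).im ^ 2) P := him.integrable_sq.const_mul _
  have i3 : Integrable (fun ω => 2 * a.re * a.im * ((X ω).re * (X ω).im)) P :=
    (hre.integrable_mul him).const_mul _
  have i4 : Integrable (fun ω => a.re ^ 2 * (X ω).re ^ 2 + a.im ^ 2 * (X ω).im ^ 2) P := i1.add i2
  have e : ∀ ω, (a * X ω).re ^ 2 = a.re ^ 2 * (X ω).re ^ 2 + a.im ^ 2 * (X ω).im ^ 2 -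
      2 * a.re * a.im * ((X ω).re * (X ω).im) := fun ω => by
    rw [Complex.mul_re]
    ring
  simp_rw [varRe, e]
  rw [integral_sub i4 i3, integral_add i1 i2, integral_const_mul, integral_const_mul,
    integral_const_mul, hcross, ← hs₁, ← hs₂]
  simp only [Complex.add_re, Complex.re_ofReal_mul]
  simp only [Complex.mul_re, Complex.conj_re, Complex.conj_im]
  ring

/-- The weights `∑ l, c l * (b(k) / (b(n) √n)) * z l ^ k * exp(k u l / n)`. -/
noncomputable def expWeight (b : ℝ → ℝ) {ι : Type} [Fintype ι] (c z u : ι → ℂ) (n k : ℕ) : ℂ :=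
  ∑ l, c l * (((b k / (b n * √(n : ℝ)) : ℝ) : ℂ) * z l ^ k * Complex.exp ((k / n : ℝ) * u l))

/-- The coefficient of `ξ k` in `∑ l, c l * P_n(exp(iψ_{j l} + u l / n)) / (b(n) √n)`, where
`p l = (j l, u l)`. -/
noncomputable def polyWeight (b : ℝ → ℝ) (ψ : Fin m → ℝ) {ι : Type} [Fintype ι]
    (p : ι → Fin m × ℂ) (c : ι → ℂ) (n k : ℕ) : ℂ :=
  expWeight b c (fun l => Complex.exp (Complex.I * ψ (p l).1)) (fun l => (p l).2) n k

theorem conj_expWeight (b : ℝ → ℝ) {ι : Type} [Fintype ι] (c z u : ι → ℂ) (n k : ℕ) :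
    conj (expWeight b c z u n k) =
      expWeight b (fun l => conj (c l)) (fun l => conj (z l)) (fun l => conj (u l)) n k := by
  simp only [expWeight, map_sum, map_mul, map_pow, Complex.conj_ofReal, ← Complex.exp_conj]

omit [MeasurableSpace Ω] in
theorem rescaledPoly_apply (b : ℝ → ℝ) (ξ : ℕ → Ω → ℂ) (ψ : ℝ) (n : ℕ) (ω : Ω) (u : ℂ) :
    rescaledPoly b ξ ψ n ω u = ∑ k ∈ Finset.range (n + 1),
      ((b k / (b n * √(n : ℝ)) : ℝ) : ℂ) * Complex.exp (Complex.I * ψ) ^ k *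
        Complex.exp ((k / n : ℝ) * u) * ξ k ω := by
  change randPoly b ξ n ω (Complex.exp (Complex.I * ψ + u / n)) / _ = _
  rw [randPoly, Finset.sum_div]
  refine Finset.sum_congr rfl fun k _ => ?_
  rw [Complex.exp_add, mul_pow, ← Complex.exp_nat_mul (u / n)]
  have : (k : ℂ) * (u / n) = ((k / n : ℝ) : ℂ) * u := by
    push_cast
    ring
  rw [this]
  push_cast
  ring

omit [MeasurableSpace Ω] in
theorem reSum_rescaledPoly {ι : Type} [Fintype ι] (p : ι → Fin m × ℂ) (c : ι → ℂ) (n : ℕ) (ω : Ω) :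
    reSum p c (fun j => rescaledPoly b ξ (ψ j) n ω) =
      (∑ k ∈ Finset.range (n + 1), polyWeight b ψ p c n k * ξ k ω).re := by
  simp only [reSum, rescaledPoly_apply, polyWeight, expWeight]
  congr 1
  simp_rw [Finset.mul_sum, Finset.sum_mul]
  rw [Finset.sum_comm]
  refine Finset.sum_congr rfl fun k _ => Finset.sum_congr rfl fun l _ => ?_
  ring

theorem sq_weight (b : ℝ → ℝ) (n k : ℕ) :
    (b k / (b n * √(n : ℝ))) ^ 2 = b k ^ 2 / (b n ^ 2 * n) := by
  rw [div_pow, mul_pow, Real.sq_sqrt (Nat.cast_nonneg n)]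

/-- Sums of products of weights are weighted Riemann sums, oscillating at the frequencies
`z l * w l'`; only the pairs with `z l * w l' = 1` survive. -/
theorem tendsto_sum_expWeight_mul (hb : IsRegularlyVarying b α) (hα : -1 / 2 < α)
    {ι : Type} [Fintype ι] {c z u d w v : ι → ℂ} (hz : ∀ l, ‖z l‖ = 1) (hw : ∀ l, ‖w l‖ = 1) :
    Tendsto (fun n : ℕ => ∑ k ∈ Finset.range (n + 1),
      expWeight b c z u n k * expWeight b d w v n k) atTop
      (𝓝 (∑ l, ∑ l', c l * d l' * if z l * w l' = 1 then kernel α (u l + v l') else 0)) := by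
  have h : ∀ l l', Tendsto (fun n : ℕ => c l * d l' *
      ∑ k ∈ Finset.range (n + 1), ((b k ^ 2 / (b n ^ 2 * n) : ℝ) : ℂ) *
        Complex.exp ((k / n : ℝ) * (u l + v l')) * (z l * w l') ^ k)
      atTop (𝓝 (c l * d l' * if z l * w l' = 1 then kernel α (u l + v l') else 0)) := fun l l' =>
    (hb.tendsto_sum_sq_div hα (f := fun x : ℝ => Complex.exp (x * (u l + v l'))) (by fun_prop)
      (z := z l * w l') (by rw [norm_mul, hz, hw, one_mul])).const_mul (c l * d l')
  refine (tendsto_finsetSum _ fun l _ => tendsto_finsetSum _ fun l' _ => h l l').congr fun n => ?_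
  have h3 : ∀ k, expWeight b c z u n k * expWeight b d w v n k =
      ∑ l, ∑ l', c l * d l' * (((b k ^ 2 / (b n ^ 2 * n) : ℝ) : ℂ) *
        Complex.exp ((k / n : ℝ) * (u l + v l')) * (z l * w l') ^ k) := by
    intro k
    rw [expWeight, expWeight, Finset.sum_mul_sum]
    refine Finset.sum_congr rfl fun l _ => Finset.sum_congr rfl fun l' _ => ?_
    rw [← sq_weight, mul_add, Complex.exp_add]
    push_cast
    ring
  simp_rw [h3]
  symm
  rw [Finset.sum_comm]
  refine Finset.sum_congr rfl fun l _ => ?_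
  rw [Finset.sum_comm]
  exact Finset.sum_congr rfl fun l' _ => (Finset.mul_sum _ _ _).symm

theorem norm_conj_exp_I_mul (x : ℝ) : ‖conj (Complex.exp (Complex.I * x))‖ = 1 := by
  rw [RCLike.norm_conj, Complex.norm_exp_I_mul_ofReal]

theorem tendsto_sum_polyWeight_mul_conj (hb : IsRegularlyVarying b α) (hα : -1 / 2 < α)
    {ι : Type} [Fintype ι] (p : ι → Fin m × ℂ) (c : ι → ℂ) :
    Tendsto (fun n : ℕ => ((s₁ + s₂ : ℝ) : ℂ) * ∑ k ∈ Finset.range (n + 1),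
      polyWeight b ψ p c n k * conj (polyWeight b ψ p c n k)) atTop
      (𝓝 (∑ l, ∑ l', c l * conj (c l') * limitCov α s₁ s₂ ψ (p l) (p l'))) := by
  simp only [polyWeight, conj_expWeight, limitCov, mul_left_comm (c _ * _), ← Finset.mul_sum]
  exact (tendsto_sum_expWeight_mul hb hα (fun _ => Complex.norm_exp_I_mul_ofReal _)
    (fun _ => norm_conj_exp_I_mul _)).const_mul _

theorem tendsto_sum_polyWeight_mul_self (hb : IsRegularlyVarying b α) (hα : -1 / 2 < α)
    {ι : Type} [Fintype ι] (p : ι → Fin m × ℂ) (c : ι → ℂ) :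
    Tendsto (fun n : ℕ => ((s₁ - s₂ : ℝ) : ℂ) * ∑ k ∈ Finset.range (n + 1),
      polyWeight b ψ p c n k * polyWeight b ψ p c n k) atTop
      (𝓝 (∑ l, ∑ l', c l * c l' * limitPcov α s₁ s₂ ψ (p l) (p l'))) := by
  simp only [polyWeight, limitPcov, mul_left_comm (c _ * _), ← Finset.mul_sum]
  exact (tendsto_sum_expWeight_mul hb hα (fun _ => Complex.norm_exp_I_mul_ofReal _)
    (fun _ => Complex.norm_exp_I_mul_ofReal _)).const_mul _

theorem eventually_norm_polyWeight_le (hb : IsRegularlyVarying b α) (hα : -1 / 2 < α)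
    {ι : Type} [Fintype ι] (p : ι → Fin m × ℂ) (c : ι → ℂ) {ε : ℝ} (hε : 0 < ε) :
    ∀ᶠ n in atTop, ∀ k ≤ n, ‖polyWeight b ψ p c n k‖ ≤ ε := by
  set D := 1 + ∑ l, ‖c l‖ * Real.exp ‖(p l).2‖ with hD
  have hD1 : 0 ≤ ∑ l, ‖c l‖ * Real.exp ‖(p l).2‖ := Finset.sum_nonneg fun l _ => by positivity
  have hD0 : 0 < D := by linarith
  filter_upwards [hb.eventually_sq_div_le hα (ε := (ε / D) ^ 2) (by positivity),
    eventually_gt_atTop 0] with n hn hn0 k hk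
  have hw : |b k / (b n * √(n : ℝ))| ≤ ε / D := by
    refine abs_le_of_sq_le_sq ?_ (by positivity)
    rw [sq_weight]
    exact hn k hk
  have hkn : |(k / n : ℝ)| ≤ 1 := by
    rw [abs_of_nonneg (by positivity)]
    exact (div_le_one (by positivity)).2 (by exact_mod_cast hk)
  calc ‖polyWeight b ψ p c n k‖ ≤ ∑ l, ‖c l‖ * (ε / D * 1 * Real.exp ‖(p l).2‖) := by
        refine (norm_sum_le _ _).trans (Finset.sum_le_sum fun l _ => ?_)
        rw [norm_mul, norm_mul, norm_mul, norm_pow, Complex.norm_exp_I_mul_ofReal, one_pow,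
          Complex.norm_real, Real.norm_eq_abs]
        gcongr
        refine (Complex.norm_exp_le_exp_norm _).trans (Real.exp_le_exp.2 ?_)
        rw [norm_mul, Complex.norm_real, Real.norm_eq_abs]
        exact mul_le_of_le_one_left (norm_nonneg _) hkn
    _ = ε / D * ∑ l, ‖c l‖ * Real.exp ‖(p l).2‖ := by
        rw [Finset.mul_sum]
        refine Finset.sum_congr rfl fun l _ => ?_
        ring
    _ ≤ ε / D * D := by
        gcongr
        linarith
    _ = ε := by field_simp

/-- The central limit theorem for the finite-dimensional distributions of the rescaled
polynomials. -/
theorem tendsto_integral_exp_reSum_rescaledPoly [IsProbabilityMeasure P]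
    (hξ_meas : ∀ k, Measurable (ξ k)) (hξ_indep : iIndepFun ξ P)
    (hξ_ident : ∀ k, IdentDistrib (ξ k) (ξ 0) P P) (hξ : MemLp (ξ 0) 2 P)
    (hξ_mean : ∫ ω, ξ 0 ω ∂P = 0) (hcross : ∫ ω, (ξ 0 ω).re * (ξ 0 ω).im ∂P = 0)
    (hs₁ : s₁ = ∫ ω, (ξ 0 ω).re ^ 2 ∂P) (hs₂ : s₂ = ∫ ω, (ξ 0 ω).im ^ 2 ∂P)
    (hb : IsRegularlyVarying b α) (hα : -1 / 2 < α)
    {ι : Type} [Fintype ι] (p : ι → Fin m × ℂ) (c : ι → ℂ) :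
    Tendsto (fun n => ∫ ω, Complex.exp
        (Complex.I * reSum p c (fun j => rescaledPoly b ξ (ψ j) n ω)) ∂P) atTop
      (𝓝 (Real.exp (-gaussVar (limitCov α s₁ s₂ ψ) (limitPcov α s₁ s₂ ψ) p c / 2) : ℂ)) := by
  simp_rw [reSum_rescaledPoly]
  -- the square sums converge, as the case `s₁ + s₂ = 1` of the covariance asymptotics
  have hsq := (Complex.continuous_re.tendsto _).comp
    (tendsto_sum_polyWeight_mul_conj (s₁ := 1) (s₂ := 0) (ψ := ψ) hb hα p c)
  refine tendsto_integral_exp_re_sum hξ_meas hξ_indep hξ_ident hξ hξ_mean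
    (fun ε hε => eventually_norm_polyWeight_le hb hα p c hε)
    (M := (∑ l, ∑ l', c l * conj (c l') * limitCov α 1 0 ψ (p l) (p l')).re + 1) ?_ ?_
  · filter_upwards [hsq.eventually_le_const (lt_add_one _)] with n hn
    refine le_trans (le_of_eq ?_) hn
    simp only [Function.comp, add_zero, Complex.ofReal_one, one_mul, Complex.re_sum,
      Complex.mul_conj, Complex.normSq_eq_norm_sq, Complex.ofReal_re]
  · have h := ((tendsto_sum_polyWeight_mul_conj (s₁ := s₁) (s₂ := s₂) (ψ := ψ) hb hα p c).add
      (tendsto_sum_polyWeight_mul_self (s₁ := s₁) (s₂ := s₂) (ψ := ψ) hb hα p c))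
    have h1 := ((Complex.continuous_re.tendsto _).comp h).div_const 2
    rw [← Finset.sum_add_distrib] at h1
    simp_rw [← Finset.sum_add_distrib] at h1
    refine h1.congr fun n => ?_
    simp only [Function.comp]
    rw [Finset.mul_sum, Finset.mul_sum, ← Finset.sum_add_distrib, Complex.re_sum, Finset.sum_div]
    refine Finset.sum_congr rfl fun k _ => ?_
    rw [varRe_eq hξ.re hξ.im hcross hs₁ hs₂]

end

end LiquidPhase

/-! ### Tightness of the rescaled polynomials -/

namespace LiquidPhase

section

variable {Ω : Type*} [MeasurableSpace Ω] {P : Measure Ω} {ξ : ℕ → Ω → ℂ} {b : ℝ → ℝ} {α : ℝ}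
  {m : ℕ} {ψ : Fin m → ℝ}

theorem measurable_rescaledPoly (hξ_meas : ∀ k, Measurable (ξ k)) (n : ℕ) :
    Measurable fun ω (j : Fin m) => rescaledPoly b ξ (ψ j) n ω := by
  refine measurable_pi_iff.2 fun j => Entire.measurable_iff.2 fun z => ?_
  simp only [rescaledPoly_apply]
  fun_prop

/-- The weight of `ξ k` in the `p`-th derivative at `0` of `u ↦ P_n(exp(iψ + u/n)) / (b(n) √n)`. -/
noncomputable def derivWeight (b : ℝ → ℝ) (ψ : ℝ) (n p k : ℕ) : ℂ :=
  ((b k / (b n * √(n : ℝ)) : ℝ) : ℂ) * Complex.exp (Complex.I * ψ) ^ k * ((k / n : ℝ) : ℂ) ^ p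

omit [MeasurableSpace Ω] in
theorem hasSum_rescaledPoly (ψ : ℝ) (n : ℕ) (ω : Ω) (u : ℂ) :
    HasSum (fun p : ℕ => (∑ k ∈ Finset.range (n + 1), derivWeight b ψ n p k * ξ k ω) * u ^ p /
      p.factorial) (rescaledPoly b ξ ψ n ω u) := by
  rw [rescaledPoly_apply]
  have h := hasSum_sum (s := Finset.range (n + 1)) fun k _ =>
    ((NormedSpace.expSeries_div_hasSum_exp (((k / n : ℝ) : ℂ) * u)).mul_left
      (((b k / (b n * √(n : ℝ)) : ℝ) : ℂ) * Complex.exp (Complex.I * ψ) ^ k)).mul_right (ξ k ω)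
  rw [← Complex.exp_eq_exp_ℂ] at h
  refine (congrArg (fun f => HasSum f _) (funext fun p => ?_)).mpr h
  rw [Finset.sum_mul, Finset.sum_div]
  refine Finset.sum_congr rfl fun k _ => ?_
  rw [derivWeight, mul_pow]
  ring

omit [MeasurableSpace Ω] in
theorem rescaledPoly_mem_range_ofCoeff {A ψ : ℝ} {n : ℕ} {ω : Ω}
    (h : ∀ p, ‖∑ k ∈ Finset.range (n + 1), derivWeight b ψ n p k * ξ k ω‖ ≤ A * 2 ^ p) :
    rescaledPoly b ξ ψ n ω ∈ Set.range (Entire.ofCoeff (A := A)) :=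
  ⟨⟨_, Entire.mem_coeffBox.2 h⟩, Subtype.ext (ContinuousMap.ext fun u =>
    (hasSum_rescaledPoly ψ n ω u).tsum_eq)⟩

theorem norm_derivWeight_sq_le {n k : ℕ} (hk : k ≤ n) (ψ : ℝ) (p : ℕ) :
    ‖derivWeight b ψ n p k‖ ^ 2 ≤ b k ^ 2 / (b n ^ 2 * n) := by
  have hkn : |(k / n : ℝ)| ≤ 1 := by
    rw [abs_of_nonneg (by positivity)]
    exact div_le_one_of_le₀ (by exact_mod_cast hk) (by positivity)
  rw [derivWeight, norm_mul, norm_mul, norm_pow, norm_pow, Complex.norm_exp_I_mul_ofReal, one_pow,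
    mul_one, Complex.norm_real, Complex.norm_real, Real.norm_eq_abs, Real.norm_eq_abs, mul_pow,
    sq_abs, sq_weight]
  exact mul_le_of_le_one_right (by positivity)
    (pow_le_one₀ (by positivity) (pow_le_one₀ (abs_nonneg _) hkn))

theorem IsRegularlyVarying.exists_sum_sq_div_le (hb : IsRegularlyVarying b α) (hα : -1 / 2 < α) :
    ∃ M : ℝ, ∀ᶠ n : ℕ in atTop, ∑ k ∈ Finset.range (n + 1), b k ^ 2 / (b n ^ 2 * n) ≤ M := by
  have h := (Complex.continuous_re.tendsto _).comp
    (hb.tendsto_sum_sq_div hα (f := fun _ => 1) continuous_const (z := 1) norm_one)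
  refine ⟨_, (h.eventually_le_const (lt_add_one _)).mono fun n hn => le_trans (le_of_eq ?_) hn⟩
  simp only [Function.comp, mul_one, one_pow, Complex.re_sum, Complex.ofReal_re]

/-- Uniformly in the order `p` of the derivative, the derivatives at `0` of the rescaled polynomials
are bounded in `L²`. -/
theorem exists_integral_norm_sq_le [IsProbabilityMeasure P] (hξ_indep : iIndepFun ξ P)
    (hξ_ident : ∀ k, IdentDistrib (ξ k) (ξ 0) P P) (hξ : MemLp (ξ 0) 2 P)
    (hξ_mean : ∫ ω, ξ 0 ω ∂P = 0) (hb : IsRegularlyVarying b α) (hα : -1 / 2 < α) :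
    ∃ M : ℝ, ∃ N : ℕ, ∀ n ≥ N, ∀ (ψ : ℝ) (p : ℕ),
      ∫ ω, ‖∑ k ∈ Finset.range (n + 1), derivWeight b ψ n p k * ξ k ω‖ ^ 2 ∂P ≤ M := by
  obtain ⟨M, hM⟩ := hb.exists_sum_sq_div_le hα
  obtain ⟨N, hN⟩ := eventually_atTop.1 hM
  refine ⟨M * ∫ ω, ‖ξ 0 ω‖ ^ 2 ∂P, N, fun n hn ψ p => ?_⟩
  rw [integral_norm_sum_sq hξ_indep hξ_ident hξ hξ_mean]
  refine mul_le_mul_of_nonneg_right ((Finset.sum_le_sum fun k hk => ?_).trans (hN n hn))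
    (integral_nonneg fun _ => by positivity)
  exact norm_derivWeight_sq_le (Nat.lt_succ_iff.1 (Finset.mem_range.1 hk)) ψ p

/-- Chebyshev's inequality for complex random variables. -/
theorem measure_lt_norm_le [IsProbabilityMeasure P] {X : Ω → ℂ} (hX : MemLp X 2 P) {a : ℝ}
    (ha : 0 < a) : P {ω | a < ‖X ω‖} ≤ ENNReal.ofReal ((∫ ω, ‖X ω‖ ^ 2 ∂P) / a ^ 2) := by
  have h := mul_meas_ge_le_integral_of_nonneg (μ := P) (f := fun ω => ‖X ω‖ ^ 2)
    (ae_of_all _ fun _ => by positivity) (integrable_norm_sq hX) (a ^ 2)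
  calc P {ω | a < ‖X ω‖} ≤ P {ω | a ^ 2 ≤ ‖X ω‖ ^ 2} :=
        measure_mono fun ω (hω : a < ‖X ω‖) =>
          Set.mem_ofPred_eq ▸ pow_le_pow_left₀ ha.le hω.le 2
    _ = ENNReal.ofReal (P.real {ω | a ^ 2 ≤ ‖X ω‖ ^ 2}) :=
        (ENNReal.ofReal_toReal (measure_ne_top _ _)).symm
    _ ≤ _ := ENNReal.ofReal_le_ofReal ((le_div_iff₀' (by positivity)).2 h)

/-- If the derivatives at `0` of the rescaled polynomials are bounded in `L²`, then with high
probability the `p`-th derivative is at most `A * 2 ^ p` for all `p`. -/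
theorem measure_rescaledPoly_notMem_le [IsProbabilityMeasure P]
    (hξ_ident : ∀ k, IdentDistrib (ξ k) (ξ 0) P P) (hξ : MemLp (ξ 0) 2 P) {M : ℝ} {n : ℕ} {ψ : ℝ}
    (hM : ∀ p, ∫ ω, ‖∑ k ∈ Finset.range (n + 1), derivWeight b ψ n p k * ξ k ω‖ ^ 2 ∂P ≤ M)
    {A : ℝ} (hA : 0 < A) :
    P {ω | rescaledPoly b ξ ψ n ω ∉ Set.range (Entire.ofCoeff (A := A))} ≤
      ENNReal.ofReal (M / A ^ 2 * (4 / 3)) := by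
  have hM0 : 0 ≤ M := (integral_nonneg fun _ => by positivity).trans (hM 0)
  have hgeom : HasSum (fun p : ℕ => M / A ^ 2 * (1 / 4 : ℝ) ^ p) (M / A ^ 2 * (4 / 3)) := by
    have h : (4 / 3 : ℝ) = (1 - 1 / 4)⁻¹ := by norm_num
    rw [h]
    exact (hasSum_geometric_of_lt_one (by norm_num) (by norm_num)).mul_left (M / A ^ 2)
  calc _ ≤ P (⋃ p : ℕ, {ω | A * 2 ^ p <
          ‖∑ k ∈ Finset.range (n + 1), derivWeight b ψ n p k * ξ k ω‖}) := by
        refine measure_mono fun ω hω => ?_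
        by_contra h
        simp only [Set.mem_iUnion, Set.mem_ofPred_eq, not_exists, not_lt] at h
        exact hω (rescaledPoly_mem_range_ofCoeff h)
    _ ≤ ∑' p : ℕ, P {ω | A * 2 ^ p <
          ‖∑ k ∈ Finset.range (n + 1), derivWeight b ψ n p k * ξ k ω‖} := measure_iUnion_le _
    _ ≤ ∑' p : ℕ, ENNReal.ofReal (M / A ^ 2 * (1 / 4) ^ p) := by
        refine ENNReal.tsum_le_tsum fun p => ?_
        refine (measure_lt_norm_le (memLp_sum hξ_ident hξ _ _) (by positivity)).trans
          (ENNReal.ofReal_le_ofReal ?_)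
        calc _ ≤ M / (A * 2 ^ p) ^ 2 := by
              gcongr
              exact hM p
          _ = _ := by
              rw [mul_pow, ← pow_mul, mul_comm p 2, pow_mul, one_div, inv_pow]
              norm_num
              field_simp
    _ = _ := by
        rw [← ENNReal.ofReal_tsum_of_nonneg (fun p => by positivity) hgeom.summable, hgeom.tsum_eq]

/-- Tightness from some index on: the random Taylor coefficients lie with high probability in a box
that corresponds to a compact set of entire functions. -/
theorem exists_isTightMeasureSet_rescaledPoly [IsProbabilityMeasure P]
    (hξ_meas : ∀ k, Measurable (ξ k)) (hξ_indep : iIndepFun ξ P)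
    (hξ_ident : ∀ k, IdentDistrib (ξ k) (ξ 0) P P) (hξ : MemLp (ξ 0) 2 P)
    (hξ_mean : ∫ ω, ξ 0 ω ∂P = 0) (hb : IsRegularlyVarying b α) (hα : -1 / 2 < α) :
    ∃ N : ℕ, IsTightMeasureSet
      {x | ∃ n ≥ N, P.map (fun ω (j : Fin m) => rescaledPoly b ξ (ψ j) n ω) = x} := by
  obtain ⟨M, N, hM⟩ := exists_integral_norm_sq_le hξ_indep hξ_ident hξ hξ_mean hb hα
  refine ⟨N, isTightMeasureSet_iff_exists_isCompact_measure_compl_le.2 fun ε hε => ?_⟩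
  have hlim : Tendsto (fun A : ℝ => (m : ENNReal) * ENNReal.ofReal (M / A ^ 2 * (4 / 3))) atTop
      (𝓝 0) := by
    have h1 : Tendsto (fun A : ℝ => M / A ^ 2 * (4 / 3)) atTop (𝓝 0) := by
      simpa using ((tendsto_pow_atTop two_ne_zero).const_div_atTop M).mul_const (4 / 3)
    simpa using ENNReal.Tendsto.const_mul (a := (m : ENNReal)) (ENNReal.tendsto_ofReal h1)
      (Or.inr (ENNReal.natCast_ne_top m))
  obtain ⟨A, hA, hA0⟩ := ((hlim.eventually_le_const hε).and (eventually_gt_atTop 0)).exists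
  have hK : IsCompact (Set.univ.pi fun _ : Fin m => Set.range (Entire.ofCoeff (A := A))) :=
    isCompact_univ_pi fun _ => Entire.isCompact_range_ofCoeff A
  refine ⟨_, hK, ?_⟩
  rintro _ ⟨n, hn, rfl⟩
  rw [Measure.map_apply (measurable_rescaledPoly hξ_meas n) hK.isClosed.measurableSet.compl]
  calc _ ≤ P (⋃ j : Fin m,
          {ω | rescaledPoly b ξ (ψ j) n ω ∉ Set.range (Entire.ofCoeff (A := A))}) := by
        refine measure_mono fun ω hω => ?_
        simpa [Set.mem_pi] using hω
    _ ≤ ∑ j : Fin m, P {ω | rescaledPoly b ξ (ψ j) n ω ∉ Set.range (Entire.ofCoeff (A := A))} :=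
        measure_iUnion_fintype_le _ _
    _ ≤ ∑ _j : Fin m, ENNReal.ofReal (M / A ^ 2 * (4 / 3)) :=
        Finset.sum_le_sum fun j _ =>
          measure_rescaledPoly_notMem_le hξ_ident hξ (hM n hn (ψ j)) hA0
    _ ≤ ε := by
        rw [Finset.sum_const, Finset.card_univ, Fintype.card_fin, nsmul_eq_mul]
        exact hA

end

end LiquidPhase

/-! ### Joint convergence in distribution -/

theorem theorem3p2 {Ω : Type*} [MeasurableSpace Ω] (P : Measure Ω) [IsProbabilityMeasure P]
    (ξ : ℕ → Ω → ℂ) (b : ℝ → ℝ) (α : ℝ)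
    -- `ξ_0, ξ_1, …` are independent copies of a complex random variable `ξ`
    (hξ_meas : ∀ k, Measurable (ξ k)) (hξ_indep : iIndepFun ξ P)
    (hξ_ident : ∀ k, IdentDistrib (ξ k) (ξ 0) P P)
    -- `E[ξ] = 0`, finite second moments, `σ² > 0`, and `Cov[Re ξ, Im ξ] = 0`
    (hξ_re : MemLp (fun ω => (ξ 0 ω).re) 2 P) (hξ_im : MemLp (fun ω => (ξ 0 ω).im) 2 P)
    (hξ_mean : ∫ ω, ξ 0 ω ∂P = 0)
    (s₁ s₂ : ℝ) (hs₁ : s₁ = ∫ ω, (ξ 0 ω).re ^ 2 ∂P) (hs₂ : s₂ = ∫ ω, (ξ 0 ω).im ^ 2 ∂P)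
    (hs : 0 < s₁ + s₂)
    (hξ_cov : cov[fun ω => (ξ 0 ω).re, fun ω => (ξ 0 ω).im; P] = 0)
    -- `b` varies regularly with index `α > -1/2`
    (hb : LiquidPhase.IsRegularlyVarying b α) (hα : -1 / 2 < α)
    -- distinct angles in `[0, 2π)`
    (m : ℕ) (ψ : Fin m → ℝ) (hψ_mem : ∀ j, ψ j ∈ Set.Ico 0 (2 * Real.pi))
    (hψ_inj : Function.Injective ψ) :
    -- a random element `(G_{ψ_1}, …, G_{ψ_m})` of `𝒜(ℂ)^m` with the stated structure exists
    (∃ ν : ProbabilityMeasure (Fin m → LiquidPhase.Entire),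
      LiquidPhase.IsGaussianLimit α s₁ s₂ ψ (fun G => G)
        (ν : Measure (Fin m → LiquidPhase.Entire))) ∧
    -- and the rescaled polynomials converge jointly in distribution on `𝒜(ℂ)^m` to any such element
    (∀ {Ω' : Type*} [MeasurableSpace Ω'] (μ : Measure Ω') [IsProbabilityMeasure μ]
      (G : Ω' → Fin m → LiquidPhase.Entire), LiquidPhase.IsGaussianLimit α s₁ s₂ ψ G μ →
      TendstoInDistribution
        (fun (n : ℕ) (ω : Ω) (j : Fin m) => LiquidPhase.rescaledPoly b ξ (ψ j) n ω)
        atTop G (fun _ => P) μ) := by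
  have hξ : MemLp (ξ 0) 2 P := memLp_re_im_iff.1 ⟨hξ_re, hξ_im⟩
  have hcross : ∫ ω, (ξ 0 ω).re * (ξ 0 ω).im ∂P = 0 := by
    have hre : ∫ ω, (ξ 0 ω).re ∂P = 0 := by
      have h : ∫ ω, (ξ 0 ω).re ∂P = (∫ ω, ξ 0 ω ∂P).re :=
        integral_re (hξ.integrable one_le_two)
      rw [h, hξ_mean, Complex.zero_re]
    rw [covariance_eq_sub hξ_re hξ_im, hre, zero_mul, sub_zero] at hξ_cov
    exact hξ_cov
  have hexp : ∀ (ι : Type) [Fintype ι] (p : ι → Fin m × ℂ) (c : ι → ℂ),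
      Continuous fun G => Complex.exp (Complex.I * LiquidPhase.reSum p c G) := fun ι _ p c => by
    have := LiquidPhase.continuous_reSum p c
    fun_prop
  have hX := fun n => LiquidPhase.measurable_rescaledPoly (b := b) (ψ := ψ) hξ_meas n
  let μ : ℕ → ProbabilityMeasure (Fin m → LiquidPhase.Entire) := fun n =>
    ⟨P.map fun ω j => LiquidPhase.rescaledPoly b ξ (ψ j) n ω,
      Measure.isProbabilityMeasure_map (hX n).aemeasurable⟩
  obtain ⟨N, hN⟩ := LiquidPhase.exists_isTightMeasureSet_rescaledPoly (ψ := ψ) hξ_meas hξ_indep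
    hξ_ident hξ hξ_mean hb hα
  have hmain := LiquidPhase.exists_and_tendsto_of_tight (μ := μ) (N := N)
    (φ := fun _ _ p c => (Real.exp (-LiquidPhase.gaussVar (LiquidPhase.limitCov α s₁ s₂ ψ)
      (LiquidPhase.limitPcov α s₁ s₂ ψ) p c / 2) : ℂ))
    (hN.subset (by rintro _ ⟨_, ⟨n, hn, rfl⟩, rfl⟩; exact ⟨n, hn, rfl⟩))
    (fun ι _ p c => by
      refine (LiquidPhase.tendsto_integral_exp_reSum_rescaledPoly (ψ := ψ) hξ_meas hξ_indep hξ_ident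
        hξ hξ_mean hcross hs₁ hs₂ hb hα p c).congr fun n => ?_
      exact (integral_map (hX n).aemeasurable (hexp ι p c).aestronglyMeasurable).symm)
  refine ⟨?_, ?_⟩
  · obtain ⟨ν, hν⟩ := hmain.1
    exact ⟨ν, LiquidPhase.isGaussianLimit_of_integral_exp_reSum hψ_mem hψ_inj hν⟩
  · intro Ω' _ ρ _ G hG
    refine ⟨fun n => (hX n).aemeasurable, hG.measurable.aemeasurable, ?_⟩
    refine hmain.2 ⟨ρ.map G, Measure.isProbabilityMeasure_map hG.measurable.aemeasurable⟩
      fun ι _ p c => ?_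
    rw [← hG.integral_exp_reSum hψ_mem hψ_inj p c]
    exact integral_map hG.measurable.aemeasurable (hexp ι p c).aestronglyMeasurable
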